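/- **Setting.** Let $\chi$ be a finite set of at least two decisions, $d\ge 1$, $Y\subset\mathbb R^d$ bounded with interior $Y^\circ$. For each $x\in\chi$ let $f_x:Y\to\mathbb R$ be bounded and Lipschitz with constant $L_1$, and $\sigma_x:Y\to(0,\infty)$ Lipschitz with constant $L_2$. Let $x^*(y)\in\arg\min_x f_x(y)$, and let $MO$ be the set of $y\in Y$ at which the minimiser is not unique. Let $a(x,y)>0$ be a probability density on $\chi\times Y^\circ$ (with respect to counting measure times Lebesgue measure), continuous in $y\in Y^\circ$ for each $x$. *Static sampling.* In runs $i=1,2,\dots$ the points $(x_{[i]},y_{[i]})$ are drawn independently from $a$, and one observes $\tilde G_{[i]}=f_{x_{[i]}}(y_{[i]})+\epsilon_{[i]}$, where, given $(x_{[i]},y_{[i]})=(x,y)$, the noise is normal with mean $0$ and standard deviation $\sigma_x(y)$; different runs are independent. *Shrinking neighborhood estimation.* Fix $c,\xi>0$ and $r_m=c\,m^{-\xi/d}$. The $m$-set $b_m^{(t)}(x,y)$ at stage $t$ consists of the runs $i\le t$ with $x_{[i]}=x$, $y_{[i]}\in Y^\circ$, $\|y_{[i]}-y\|<r_m$; it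 is activated once $|b_m^{(t)}(x,y)|\ge m$. Let $\Psi^{(t)}_{x,y}$ be the largest $m\ge1$ whose $m$-set is activated at stage $t$, and let $\hat f_x^{(t)}(y)$ be the average of the $\Psi^{(t)}_{x,y}$ observations in that $m$-set at the stage $t'\le t$ at which it was first activated. Let $\hat x^{(t)}(y)\in\arg\min_x\hat f^{(t)}_x(y)$, with ties broken in any measurable (possibly random) way, and with an arbitrary measurable choice if for some $x$ no $m$-set is activated yet. *Loss.* Let $\delta$ be a Borel measurable metric on $\mathbb R$, $\upsilon^{(t)}(y)=E\,\delta\big(f_{\hat x^{(t)}(y)}(y),f_{x^*(y)}(y)\big)$, $P_Y$ a Borel probability measure on $Y$, and $\varpi^{(t)}_{Y_{sub}}=\int_{Y_{sub}}\upsilon^{(t)}(y)\,dP_Y(y)$. **Proposition.** Let $Y_{sub}\subset Y^\circ$ be non-empty and compact with $Y_{sub}\cap MO=\emptyset$, and suppose that $\delta(f_x(y),f_{x^*(y)}(y))$ is bounded over $x\in\chi$, $y\in Y_{sub}$ (automatic if $\delta$ is bounded on bounded sets). Put $$H'_y=C^{\frac1{1+\xi}}\min_{x\in\chi}\Big\{\zeta_x(y)\big(-W_{-1}(-e^{-\zeta_x(y)-1})\big)^{-\frac1{1+\xi}}a(x,y)^{\frac1{1+\xi}}\Big\},\qquad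 C=\frac{\pi^{d/2}}{\Gamma(\frac d2+1)}c^d,$$ $$\zeta_x(y)=\frac{(f_x(y)-f_{x^*(y)}(y))^2}{4\sigma_x^2(y)}\ \ (x\ne x^*(y)),\qquad \zeta_{x^*(y)}(y)=\frac{(\min_{x\ne x^*(y)}f_x(y)-f_{x^*(y)}(y))^2}{4\sigma_{x^*(y)}^2(y)},$$ where $W_{-1}$ is the lower branch of the Lambert function: $W_{-1}(z)$ is the unique $w\le-1$ with $we^w=z$, for $z\in[-e^{-1},0)$. Then, with $H'_{Y_{sub}}=\inf_{y\in Y_{sub}}H'_y$, $$\liminf_{t\to\infty}-\frac1{t^{1/(1+\xi)}}\ln\varpi^{(t)}_{Y_{sub}}\ \ge\ H'_{Y_{sub}}>0$$ (with $\ln 0=-\infty$); that is, $H'_{Y_{sub}}>0$, and for every $h<H'_{Y_{sub}}$, $\varpi^{(t)}_{Y_{sub}}\le e^{-h\,t^{1/(1+\xi)}}$ for all large $t$. -/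

import Mathlib

open scoped ENNReal NNReal Topology
open MeasureTheory ProbabilityTheory Filter

noncomputable section

namespace SNE

/-! ### The decision problem -/

/-- An optimal decision `x*(y)`: a minimiser of `x ↦ f x y` over the finite decision set
(it is the only one when `y` is not a multi-optimum context). -/
def xstar {χ E : Type*} [Finite χ] [Nonempty χ] (f : χ → E → ℝ) (y : E) : χ :=
  Classical.choose (Finite.exists_min (fun x => f x y))

/-- The multi-optimum contexts: those `y ∈ Y` with at least two optimal decisions. -/
def multiOpt {χ E : Type*} (f : χ → E → ℝ) (Y : Set E) : Set E :=
  {y | y ∈ Y ∧ ∃ x₁ x₂ : χ, x₁ ≠ x₂ ∧ (∀ x, f x₁ y ≤ f x y) ∧ (∀ x, f x₂ y ≤ f x y)}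

/-- `δ` is a metric on the real line. -/
structure IsMetric (δ : ℝ → ℝ → ℝ) : Prop where
  eq_zero_iff : ∀ u v, δ u v = 0 ↔ u = v
  symm : ∀ u v, δ u v = δ v u
  triangle : ∀ u v w, δ u w ≤ δ u v + δ v w

/-! ### Static random sampling -/

/-- A static random sampling with density `a` on `χ × interior Y`.

In run `i` the pair `(X i, S i)` is drawn from the density `a`, and the noise of the run is
`σ_x(y) * Z i` at `(x, y) = (X i, S i)`, where `Z i` is standard normal and independent of
`(X i, S i)`; so, given `(X i, S i) = (x, y)`, the noise has the law `N(0, σ_x(y)²)`.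
Different runs are independent. -/
structure IsStaticSampling {χ Ω : Type*} [MeasurableSpace χ] [MeasurableSpace Ω] {d : ℕ}
    (Y : Set (EuclideanSpace ℝ (Fin d))) (a : χ → EuclideanSpace ℝ (Fin d) → ℝ)
    (P : Measure Ω) (X : ℕ → Ω → χ) (S : ℕ → Ω → EuclideanSpace ℝ (Fin d))
    (Z : ℕ → Ω → ℝ) : Prop where
  measurable_X : ∀ i, Measurable (X i)
  measurable_S : ∀ i, Measurable (S i)
  measurable_Z : ∀ i, Measurable (Z i)
  law_design : ∀ (i : ℕ) (x : χ) (V : Set (EuclideanSpace ℝ (Fin d))), MeasurableSet V →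
    P {ω | X i ω = x ∧ S i ω ∈ V} = ∫⁻ y in V ∩ interior Y, ENNReal.ofReal (a x y)
  law_noise : ∀ i, P.map (Z i) = gaussianReal 0 1
  indep_noise : ∀ i, IndepFun (fun ω => (X i ω, S i ω)) (Z i) P
  indep_runs : iIndepFun (fun i ω => (X i ω, S i ω, Z i ω)) P

/-- The observation of run `i`: `f_x(y) + σ_x(y) * Z i` at `(x, y) = (X i, S i)`. -/
def obs {χ Ω E : Type*} (f σ : χ → E → ℝ) (X : ℕ → Ω → χ) (S : ℕ → Ω → E)
    (Z : ℕ → Ω → ℝ) (i : ℕ) (ω : Ω) : ℝ :=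
  f (X i ω) (S i ω) + σ (X i ω) (S i ω) * Z i ω

/-! ### Shrinking neighborhood estimation

A data set is given by its sequences `xs`, `ys`, `gs` of decisions, contexts and observations;
the runs available at stage `t` are those with index `i < t`. -/

/-- The radii `r_m = c m^(-ξ/d)`. -/
def radius (d : ℕ) (c ξ : ℝ) (m : ℕ) : ℝ := c * (m : ℝ) ^ (-ξ / (d : ℝ))

section estimator

variable {χ : Type*} {d : ℕ}

open Classical in
/-- The `m`-set at `(x, y)` on stage `t` (as a set of run indices). -/
def mSet (Y : Set (EuclideanSpace ℝ (Fin d))) (c ξ : ℝ)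
    (xs : ℕ → χ) (ys : ℕ → EuclideanSpace ℝ (Fin d))
    (x : χ) (y : EuclideanSpace ℝ (Fin d)) (m t : ℕ) : Finset ℕ :=
  (Finset.range t).filter
    (fun i => xs i = x ∧ ‖ys i - y‖ < radius d c ξ m ∧ ys i ∈ interior Y)

/-- `Ψ`: the largest `m` whose `m`-set is activated on stage `t`, that is, holds at least `m`
runs (`m ≤ t` is then automatic); it is `0` if no `m`-set with `m ≥ 1` is activated. -/
def psi (Y : Set (EuclideanSpace ℝ (Fin d))) (c ξ : ℝ)
    (xs : ℕ → χ) (ys : ℕ → EuclideanSpace ℝ (Fin d))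
    (x : χ) (y : EuclideanSpace ℝ (Fin d)) (t : ℕ) : ℕ :=
  Nat.findGreatest (fun m => m ≤ (mSet Y c ξ xs ys x y m t).card) t

/-- The stage, not later than `t`, on which the `Ψ`-set was activated. -/
def activation (Y : Set (EuclideanSpace ℝ (Fin d))) (c ξ : ℝ)
    (xs : ℕ → χ) (ys : ℕ → EuclideanSpace ℝ (Fin d))
    (x : χ) (y : EuclideanSpace ℝ (Fin d)) (t : ℕ) : ℕ :=
  sInf {s | s ≤ t ∧
    (mSet Y c ξ xs ys x y (psi Y c ξ xs ys x y t) s).card = psi Y c ξ xs ys x y t}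

/-- The neighborhood samples: the `Ψ`-set as it was when it was activated. -/
def nbhd (Y : Set (EuclideanSpace ℝ (Fin d))) (c ξ : ℝ)
    (xs : ℕ → χ) (ys : ℕ → EuclideanSpace ℝ (Fin d))
    (x : χ) (y : EuclideanSpace ℝ (Fin d)) (t : ℕ) : Finset ℕ :=
  mSet Y c ξ xs ys x y (psi Y c ξ xs ys x y t) (activation Y c ξ xs ys x y t)

/-- The estimate of `f_x(y)` on stage `t`: the average over the neighborhood samples
(meaningful only when `Ψ ≥ 1`). -/
def fhat (Y : Set (EuclideanSpace ℝ (Fin d))) (c ξ : ℝ)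
    (xs : ℕ → χ) (ys : ℕ → EuclideanSpace ℝ (Fin d)) (gs : ℕ → ℝ)
    (x : χ) (y : EuclideanSpace ℝ (Fin d)) (t : ℕ) : ℝ :=
  (1 / (psi Y c ξ xs ys x y t : ℝ)) * ∑ i ∈ nbhd Y c ξ xs ys x y t, gs i

end estimator

/-- `xhat` is an inferred optimal decision: `xhat t ω y` minimises the estimates on stage `t`.
Ties may be broken in any measurable way, also at random. When some estimate is undefined
(no activated `m`-set), any decision is allowed. -/
structure IsInferred {χ Ω : Type*} [MeasurableSpace χ] [MeasurableSpace Ω] {d : ℕ}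
    (Y : Set (EuclideanSpace ℝ (Fin d))) (c ξ : ℝ)
    (f σ : χ → EuclideanSpace ℝ (Fin d) → ℝ)
    (X : ℕ → Ω → χ) (S : ℕ → Ω → EuclideanSpace ℝ (Fin d)) (Z : ℕ → Ω → ℝ)
    (xhat : ℕ → Ω → EuclideanSpace ℝ (Fin d) → χ) : Prop where
  measurable : ∀ t, Measurable (fun p : Ω × EuclideanSpace ℝ (Fin d) => xhat t p.1 p.2)
  isMin : ∀ t ω, ∀ y ∈ interior Y,
    (∀ x, 1 ≤ psi Y c ξ (fun i => X i ω) (fun i => S i ω) x y t) →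
    ∀ x, fhat Y c ξ (fun i => X i ω) (fun i => S i ω) (fun i => obs f σ X S Z i ω)
          (xhat t ω y) y t ≤
        fhat Y c ξ (fun i => X i ω) (fun i => S i ω) (fun i => obs f σ X S Z i ω) x y t

/-! ### Decision loss -/

/-- The expected decision loss `υ(y) = E δ(f_{xhat(y)}(y), f_{x*(y)}(y))` for a random
decision `xhat`. -/
def condLoss {χ Ω E : Type*} [Finite χ] [Nonempty χ] [MeasurableSpace Ω]
    (δ : ℝ → ℝ → ℝ) (f : χ → E → ℝ) (P : Measure Ω) (xhat : Ω → E → χ) (y : E) : ℝ≥0∞ :=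
  ∫⁻ ω, ENNReal.ofReal (δ (f (xhat ω y) y) (f (xstar f y) y)) ∂P

/-- The total decision loss `∫_{Ysub} υ(y) dμ(y)`. -/
def totalLoss {χ Ω E : Type*} [Finite χ] [Nonempty χ] [MeasurableSpace Ω] [MeasurableSpace E]
    (δ : ℝ → ℝ → ℝ) (f : χ → E → ℝ) (P : Measure Ω) (xhat : Ω → E → χ)
    (μ : Measure E) (Ysub : Set E) : ℝ≥0∞ :=
  ∫⁻ y in Ysub, condLoss δ f P xhat y ∂μ

/-! ### The rate -/

/-- The lower branch `W₋₁` of the Lambert function: for `z ∈ [-1/e, 0)`, the only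
`w ≤ -1` with `w e^w = z`. -/
def lambertWm1 (z : ℝ) : ℝ := sInf {w : ℝ | w ≤ -1 ∧ w * Real.exp w = z}

open Classical in
/-- The signal-to-noise ratio `ζ_x(y)`. -/
def zeta {χ E : Type*} [Finite χ] [Nonempty χ] (f σ : χ → E → ℝ) (x : χ) (y : E) : ℝ :=
  if x = xstar f y then
    ((⨅ x' : {x' : χ // x' ≠ xstar f y}, f x'.1 y) - f (xstar f y) y) ^ 2
      / (4 * σ (xstar f y) y ^ 2)
  else (f x y - f (xstar f y) y) ^ 2 / (4 * σ x y ^ 2)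

/-- `C = π^(d/2) / Γ(d/2 + 1) * c^d`. -/
def volConst (d : ℕ) (c : ℝ) : ℝ :=
  Real.pi ^ ((d : ℝ) / 2) / Real.Gamma ((d : ℝ) / 2 + 1) * c ^ d

/-- The rate `H'_y`. -/
def rate {χ : Type*} [Finite χ] [Nonempty χ] {d : ℕ} (c ξ : ℝ)
    (f σ a : χ → EuclideanSpace ℝ (Fin d) → ℝ) (y : EuclideanSpace ℝ (Fin d)) : ℝ :=
  volConst d c ^ (1 / (1 + ξ)) *
    ⨅ x : χ, zeta f σ x y * (-lambertWm1 (-Real.exp (-zeta f σ x y - 1))) ^ (-(1 / (1 + ξ)))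
      * a x y ^ (1 / (1 + ξ))

/-- The rate `H'_{Ysub}`, the infimum of `H'_y` over `y ∈ Ysub`. -/
def rateSub {χ : Type*} [Finite χ] [Nonempty χ] {d : ℕ} (c ξ : ℝ)
    (f σ a : χ → EuclideanSpace ℝ (Fin d) → ℝ) (Ysub : Set (EuclideanSpace ℝ (Fin d))) : ℝ :=
  ⨅ y : Ysub, rate c ξ f σ a y.1

end SNE

end

/-! Write T = t^(1/(1+ξ)), fix a context y₀ with a unique optimal decision, and compare each sample
size Ψ_x with a threshold ⌈κ_x T⌉. A wrong decision needs one of two rare events: some Ψ_x stays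
below its threshold, or all samples are large and yet two estimates are in the wrong order.

The first event is a binomial lower tail. A ball of radius r_m has volume C m^(-ξ), so with tilt θ
the Chernoff bound (`prob_psi_lt_le`) has exponent about T (a C κ^(-ξ) (1 - e^(-θ)) - θ κ), because
t m^(-ξ) scales like T when m ≈ κT.

For the second event, the neighborhood samples are determined by the design alone, and the design is
independent of the noise (`indepFun_sequences`). Given the design, the noise in an estimate is a
Gaussian average of variance at most about σ²/(κT), and the bias vanishes with the radius. With gap
Δ, the misordering exponent (`prob_misorder_le`) is about T Δ² / (2 (σ_x²/κ_x + σ_{x*}²/κ_{x*})).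

Take κ^(1+ξ) = a C / W with W = -W₋₁(-e^(-ζ-1)), and θ = log W. The first exponent becomes κ (W - 1
- log W) T, which is κζT by the Lambert equation. Since κζ is the term of x in the minimum defining
H', every h > 0 below H' satisfies σ²/κ < Δ²/(4h) for both decisions, so the second exponent also
exceeds hT (`exists_tilt`, `eventually_gaussian_exponent`).

All inequalities are strict and the data are continuous, so the bounds hold uniformly near y₀
(`exists_nhds_prob_wrong_le`). Compactness makes them uniform on the whole subset, and an
arbitrarily small loss in h absorbs the constant factors. Positivity of the infimum rate comes from
the explicit bound W ≤ 2(ζ + 1), so continuity of W₋₁ is never needed. -/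

namespace SNE

/-! ### The Lambert function -/

/-- For `s > 0` the number `w = -W₋₁(-e^{-s-1})` satisfies `1 < w ≤ 2 (s + 1)` and
`w - log w = s + 1`. -/
theorem lambertWm1_spec {s : ℝ} (hs : 0 < s) :
    1 < -lambertWm1 (-Real.exp (-s - 1)) ∧
      -lambertWm1 (-Real.exp (-s - 1)) - Real.log (-lambertWm1 (-Real.exp (-s - 1))) = s + 1 ∧
      -lambertWm1 (-Real.exp (-s - 1)) ≤ 2 * (s + 1) := by
  set A : Set ℝ := {w : ℝ | w ≤ -1 ∧ w * Real.exp w = -Real.exp (-s - 1)} with hA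
  -- The tangent to log at 2 gives log v ≤ v/2 + log 2 - 1. This is the source of the bound 2(s +
  -- 1), since w = s + 1 + log w ≤ s + 1 + w/2.
  have hlog : ∀ v : ℝ, 0 < v → Real.log v ≤ v / 2 := by
    intro v hv
    have h1 := Real.add_one_le_exp (Real.log v / 2 - Real.log 2 / 2)
    have h2 := Real.log_le_sub_one_of_pos (show (0 : ℝ) < v / 2 by positivity)
    rw [Real.log_div hv.ne' two_ne_zero] at h2
    have := Real.log_two_lt_d9
    linarith
  have key : ∀ w ∈ A, -w - Real.log (-w) = s + 1 := by
    rintro w ⟨hw, he⟩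
    have hw0 : 0 < -w := by linarith
    have h := congrArg (fun u => Real.log (-u)) he
    simp only [neg_neg, Real.log_exp] at h
    rw [← neg_mul, Real.log_mul hw0.ne' (Real.exp_pos _).ne', Real.log_exp] at h
    linarith
  have bdd : ∀ w ∈ A, -(2 * (s + 1)) ≤ w := by
    intro w hw
    have h1 := key w hw
    have h2 := hlog (-w) (by linarith [hw.1])
    linarith
  -- Intermediate values: v - log v is at most s + 1 at v = 1 and at least s + 1 at v = 2(s + 1).
  have hne : A.Nonempty := by
    have hc : ContinuousOn (fun v : ℝ => v - Real.log v) (Set.Icc 1 (2 * (s + 1))) := by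
      refine continuousOn_id.sub (Real.continuousOn_log.mono ?_)
      intro v hv
      have : (0 : ℝ) < v := by linarith [hv.1]
      exact this.ne'
    have hmem : s + 1 ∈ Set.Icc ((1 : ℝ) - Real.log 1) (2 * (s + 1) - Real.log (2 * (s + 1))) := by
      refine ⟨by simp; linarith, ?_⟩
      have := hlog (2 * (s + 1)) (by linarith)
      linarith
    obtain ⟨v, hv, hve⟩ := intermediate_value_Icc (by linarith) hc hmem
    have hv0 : (0 : ℝ) < v := by linarith [hv.1]
    refine ⟨-v, by linarith [hv.1], ?_⟩
    have h3 : -s - 1 = Real.log v + -v := by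
      simp only at hve; linarith
    rw [h3, Real.exp_add, Real.exp_log hv0]
    ring
  -- Closed, nonempty and bounded below, so the infimum belongs to `A`; uniqueness of the solution
  -- is not needed.
  have hcl : IsClosed A :=
    (isClosed_le continuous_id continuous_const).inter
      (isClosed_eq (continuous_id.mul Real.continuous_exp) continuous_const)
  have hmem : sInf A ∈ A := hcl.csInf_mem hne ⟨_, bdd⟩
  have hl : lambertWm1 (-Real.exp (-s - 1)) = sInf A := rfl
  rw [hl]
  refine ⟨?_, key _ hmem, by linarith [bdd _ hmem]⟩
  rcases lt_or_eq_of_le hmem.1 with h | h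
  · linarith
  · have := key _ hmem
    rw [h] at this
    norm_num at this
    linarith

/-! ### Neighborhood samples -/

section estimator

variable {χ : Type*} {d : ℕ} {Y : Set (EuclideanSpace ℝ (Fin d))} {c ξ : ℝ}
  {xs : ℕ → χ} {ys : ℕ → EuclideanSpace ℝ (Fin d)} {x : χ} {y : EuclideanSpace ℝ (Fin d)}

theorem mem_mSet {m t i : ℕ} : i ∈ mSet Y c ξ xs ys x y m t ↔
    i < t ∧ xs i = x ∧ ‖ys i - y‖ < radius d c ξ m ∧ ys i ∈ interior Y := by
  classical simp [mSet]

theorem mSet_subset_range {m t : ℕ} : mSet Y c ξ xs ys x y m t ⊆ Finset.range t := by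
  unfold mSet
  classical exact Finset.filter_subset _ _

theorem card_mSet_le {m t : ℕ} : (mSet Y c ξ xs ys x y m t).card ≤ t := by
  simpa using Finset.card_le_card (mSet_subset_range (Y := Y) (c := c) (ξ := ξ) (xs := xs)
    (ys := ys) (x := x) (y := y) (m := m) (t := t))

theorem mSet_eq_filter {m s t : ℕ} (hst : s ≤ t) :
    mSet Y c ξ xs ys x y m s = (mSet Y c ξ xs ys x y m t).filter (· < s) := by
  ext i
  simp only [mem_mSet, Finset.mem_filter]
  constructor
  · rintro ⟨h, h'⟩
    exact ⟨⟨h.trans_le hst, h'⟩, h⟩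
  · rintro ⟨⟨_, h'⟩, h⟩
    exact ⟨h, h'⟩

theorem card_mSet_succ_le {m s : ℕ} :
    (mSet Y c ξ xs ys x y m (s + 1)).card ≤ (mSet Y c ξ xs ys x y m s).card + 1 := by
  classical
  refine (Finset.card_le_card (t := insert s (mSet Y c ξ xs ys x y m s)) ?_).trans
    (Finset.card_insert_le _ _)
  intro i hi
  rw [mem_mSet] at hi
  rw [Finset.mem_insert, mem_mSet]
  rcases Nat.lt_succ_iff_lt_or_eq.1 hi.1 with h | h
  · exact Or.inr ⟨h, hi.2⟩
  · exact Or.inl h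

/-- A discrete intermediate value argument: an `m`-set starts empty and gains at most one run per
stage. -/
theorem exists_card_mSet_eq {m t k : ℕ} (hk : k ≤ (mSet Y c ξ xs ys x y m t).card) :
    ∃ s ≤ t, (mSet Y c ξ xs ys x y m s).card = k := by
  induction t with
  | zero =>
    refine ⟨0, le_rfl, ?_⟩
    have := card_mSet_le (Y := Y) (c := c) (ξ := ξ) (xs := xs) (ys := ys) (x := x) (y := y)
      (m := m) (t := 0)
    omega
  | succ t ih =>
    by_cases h : k ≤ (mSet Y c ξ xs ys x y m t).card
    · obtain ⟨s, hs, h'⟩ := ih h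
      exact ⟨s, hs.trans t.le_succ, h'⟩
    · have := card_mSet_succ_le (Y := Y) (c := c) (ξ := ξ) (xs := xs) (ys := ys) (x := x) (y := y)
        (m := m) (s := t)
      exact ⟨t + 1, le_rfl, by omega⟩

/-- The value `m = 0` always qualifies, so this also covers the case that nothing is activated. -/
theorem psi_le_card {t : ℕ} : psi Y c ξ xs ys x y t ≤
    (mSet Y c ξ xs ys x y (psi Y c ξ xs ys x y t) t).card :=
  Nat.findGreatest_spec (P := fun m => m ≤ (mSet Y c ξ xs ys x y m t).card)
    (Nat.zero_le t) (Nat.zero_le _)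

theorem psi_le {t : ℕ} : psi Y c ξ xs ys x y t ≤ t := Nat.findGreatest_le t

theorem le_psi {m t : ℕ} (h : m ≤ (mSet Y c ξ xs ys x y m t).card) :
    m ≤ psi Y c ξ xs ys x y t :=
  Nat.le_findGreatest (P := fun m => m ≤ (mSet Y c ξ xs ys x y m t).card)
    (h.trans card_mSet_le) h

/-- The infimum defining `activation` is over a nonempty set, hence attained. So `fhat` divides by
the exact number of its summands. -/
theorem activation_spec {t : ℕ} : activation Y c ξ xs ys x y t ≤ t ∧
    (nbhd Y c ξ xs ys x y t).card = psi Y c ξ xs ys x y t := by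
  obtain ⟨s, hs⟩ := exists_card_mSet_eq (psi_le_card (Y := Y) (c := c) (ξ := ξ) (xs := xs)
    (ys := ys) (x := x) (y := y) (t := t))
  exact Nat.sInf_mem (s := {s | s ≤ t ∧ (mSet Y c ξ xs ys x y (psi Y c ξ xs ys x y t) s).card
    = psi Y c ξ xs ys x y t}) ⟨s, hs⟩

theorem nbhd_subset {t : ℕ} : nbhd Y c ξ xs ys x y t ⊆
    mSet Y c ξ xs ys x y (psi Y c ξ xs ys x y t) t := by
  rw [nbhd, mSet_eq_filter activation_spec.1]
  classical exact Finset.filter_subset _ _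

/-- The neighborhood samples only depend on the final `m`-sets. -/
theorem nbhd_congr {t : ℕ} {xs' : ℕ → χ} {ys' : ℕ → EuclideanSpace ℝ (Fin d)}
    (h : ∀ m ≤ t, mSet Y c ξ xs ys x y m t = mSet Y c ξ xs' ys' x y m t) :
    psi Y c ξ xs ys x y t = psi Y c ξ xs' ys' x y t ∧
      nbhd Y c ξ xs ys x y t = nbhd Y c ξ xs' ys' x y t := by
  have h1 : psi Y c ξ xs ys x y t = psi Y c ξ xs' ys' x y t := by
    refine le_antisymm (le_psi ?_) (le_psi ?_)
    · rw [← h _ psi_le]; exact psi_le_card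
    · rw [h _ psi_le]; exact psi_le_card
  have h2 : ∀ m ≤ t, ∀ s ≤ t, mSet Y c ξ xs ys x y m s = mSet Y c ξ xs' ys' x y m s := by
    intro m hm s hs
    rw [mSet_eq_filter hs, mSet_eq_filter hs, h m hm]
  have h3 : activation Y c ξ xs ys x y t = activation Y c ξ xs' ys' x y t := by
    unfold activation
    congr 1
    ext s
    simp only [Set.mem_ofPred_eq]
    refine and_congr_right fun hs => ?_
    rw [← h1, h2 _ psi_le s hs]
  refine ⟨h1, ?_⟩
  rw [nbhd, nbhd, ← h1, ← h3, h2 _ psi_le _ activation_spec.1]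

end estimator

/-! ### Independence of design and noise; Gaussian and Chernoff tails -/

section probability

variable {Ω : Type*} [MeasurableSpace Ω] {P : Measure Ω} [IsProbabilityMeasure P]

/-- If the pairs `(U i, V i)` are independent and `U i` is independent of `V i` for all `i`, then
the sequence `U` is independent of the sequence `V`. -/
theorem indepFun_sequences {α β : Type*} [MeasurableSpace α] [MeasurableSpace β]
    {U : ℕ → Ω → α} {V : ℕ → Ω → β} (hU : ∀ i, Measurable (U i)) (hV : ∀ i, Measurable (V i))
    (hUV : ∀ i, IndepFun (U i) (V i) P) (h : iIndepFun (fun i ω => (U i ω, V i ω)) P) :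
    IndepFun (fun ω i => U i ω) (fun ω i => V i ω) P := by
  classical
  have hmU : Measurable (fun ω i => U i ω) := measurable_pi_lambda _ hU
  have hmV : Measurable (fun ω i => V i ω) := measurable_pi_lambda _ hV
  -- Finite-dimensional cylinders form a π-system generating the product σ-algebra, so it suffices
  -- to factor probabilities on them.
  refine IndepSets.indep hmU.comap_le hmV.comap_le
    (isPiSystem_squareCylinders (C := fun _ : ℕ => {s : Set α | MeasurableSet s})
      (fun _ => MeasurableSpace.isPiSystem_measurableSet)
      (fun _ => MeasurableSet.univ) |>.comap (fun ω i => U i ω))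
    (isPiSystem_squareCylinders (C := fun _ : ℕ => {s : Set β | MeasurableSet s})
      (fun _ => MeasurableSpace.isPiSystem_measurableSet)
      (fun _ => MeasurableSet.univ) |>.comap (fun ω i => V i ω)) ?_ ?_ ?_
  · rw [← generateFrom_squareCylinders, MeasurableSpace.comap_generateFrom]
    rfl
  · rw [← generateFrom_squareCylinders, MeasurableSpace.comap_generateFrom]
    rfl
  rw [IndepSets_iff]
  rintro _ _ ⟨_, ⟨s, A, hA, rfl⟩, rfl⟩ ⟨_, ⟨s', B, hB, rfl⟩, rfl⟩
  -- Padding with the whole space puts both cylinders on the common index set `s ∪ s'`.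
  set A' : ℕ → Set α := fun i => if i ∈ s then A i else Set.univ with hA'
  set B' : ℕ → Set β := fun i => if i ∈ s' then B i else Set.univ with hB'
  have mA : ∀ i, MeasurableSet (A' i) := by
    intro i; simp only [hA']; split_ifs
    · exact hA i trivial
    · exact .univ
  have mB : ∀ i, MeasurableSet (B' i) := by
    intro i; simp only [hB']; split_ifs
    · exact hB i trivial
    · exact .univ
  have eA : (fun ω i => U i ω) ⁻¹' ((s : Set ℕ).pi A) =
      ⋂ i ∈ s ∪ s', (fun ω => (U i ω, V i ω)) ⁻¹' (A' i ×ˢ Set.univ) := by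
    ext ω
    simp only [Set.mem_preimage, Set.mem_pi, Finset.mem_coe, Set.mem_iInter, Finset.mem_union,
      Set.mem_prod, Set.mem_univ, and_true, hA']
    constructor
    · intro h i _
      split_ifs with hi
      · exact h i hi
      · trivial
    · intro h i hi
      simpa [hi] using h i (Or.inl hi)
  have eB : (fun ω i => V i ω) ⁻¹' ((s' : Set ℕ).pi B) =
      ⋂ i ∈ s ∪ s', (fun ω => (U i ω, V i ω)) ⁻¹' (Set.univ ×ˢ B' i) := by
    ext ω
    simp only [Set.mem_preimage, Set.mem_pi, Finset.mem_coe, Set.mem_iInter, Finset.mem_union,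
      Set.mem_prod, Set.mem_univ, true_and, hB']
    constructor
    · intro h i _
      split_ifs with hi
      · exact h i hi
      · trivial
    · intro h i hi
      simpa [hi] using h i (Or.inr hi)
  have eAB : (⋂ i ∈ s ∪ s', (fun ω => (U i ω, V i ω)) ⁻¹' (A' i ×ˢ Set.univ)) ∩
      (⋂ i ∈ s ∪ s', (fun ω => (U i ω, V i ω)) ⁻¹' (Set.univ ×ˢ B' i)) =
      ⋂ i ∈ s ∪ s', (fun ω => (U i ω, V i ω)) ⁻¹' (A' i ×ˢ B' i) := by
    ext ω
    simp only [Set.mem_inter_iff, Set.mem_iInter, Set.mem_preimage, Set.mem_prod, Set.mem_univ,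
      and_true, true_and]
    exact ⟨fun h i hi => ⟨h.1 i hi, h.2 i hi⟩, fun h => ⟨fun i hi => (h i hi).1,
      fun i hi => (h i hi).2⟩⟩
  rw [eA, eB, eAB,
    h.measure_inter_preimage_eq_mul (s ∪ s') (sets := fun i => A' i ×ˢ B' i)
      (fun i _ => (mA i).prod (mB i)),
    h.measure_inter_preimage_eq_mul (s ∪ s') (sets := fun i => A' i ×ˢ Set.univ)
      (fun i _ => (mA i).prod .univ),
    h.measure_inter_preimage_eq_mul (s ∪ s') (sets := fun i => Set.univ ×ˢ B' i)
      (fun i _ => MeasurableSet.univ.prod (mB i)),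
    ← Finset.prod_mul_distrib]
  refine Finset.prod_congr rfl fun i _ => ?_
  have := (hUV i).measure_inter_preimage_eq_mul (A' i) (B' i) (mA i) (mB i)
  convert this using 3 <;> (ext ω; simp)

/-- The tail of a linear combination of independent standard normal variables. -/
theorem gaussian_sum_tail {Z : ℕ → Ω → ℝ} (hZ : ∀ i, Measurable (Z i))
    (hlaw : ∀ i, P.map (Z i) = gaussianReal 0 1) (hind : iIndepFun Z P) (s : Finset ℕ)
    (w : ℕ → ℝ) {V g : ℝ} (hV : ∑ i ∈ s, w i ^ 2 ≤ V) (hg : 0 ≤ g) :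
    P {ω | g ≤ ∑ i ∈ s, w i * Z i ω} ≤ ENNReal.ofReal (Real.exp (-g ^ 2 / (2 * V))) := by
  have hV0 : 0 ≤ V := (Finset.sum_nonneg fun i _ => sq_nonneg _).trans hV
  have h1 : ∀ i, HasSubgaussianMGF (Z i) 1 P := by
    intro i
    refine ⟨fun t => ?_, fun t => ?_⟩
    · have := integrable_exp_mul_gaussianReal (μ := 0) (v := 1) t
      rw [← hlaw i] at this
      exact this.comp_measurable (hZ i)
    · rw [mgf_gaussianReal (hlaw i)]
      simp
  set v : ℕ → ℝ≥0 := fun i => ⟨w i ^ 2, sq_nonneg _⟩ with hv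
  have h2 : HasSubgaussianMGF (fun ω => ∑ i ∈ s, w i * Z i ω)
      (∑ i ∈ s, v i) P :=
    HasSubgaussianMGF.sum_of_iIndepFun
      (hind.comp (fun i u => w i * u) (fun i => measurable_const_mul _))
      (fun i _ => by
        have h0 := (h1 i).const_mul (w i)
        have h0' : HasSubgaussianMGF (fun ω => w i * Z i ω) (v i * 1) P := h0
        rwa [mul_one] at h0')
  have h3 : HasSubgaussianMGF (fun ω => ∑ i ∈ s, w i * Z i ω) ⟨V, hV0⟩ P := by
    refine ⟨h2.integrable_exp_mul, fun t => (h2.mgf_le t).trans ?_⟩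
    refine Real.exp_le_exp.2 ?_
    have : ((∑ i ∈ s, v i : ℝ≥0) : ℝ) ≤ V := by
      rw [NNReal.coe_sum]
      exact hV
    have h0 := mul_le_mul_of_nonneg_right this (sq_nonneg t)
    change _ ≤ V * t ^ 2 / 2
    linarith
  have h4 := h3.measure_ge_le hg
  rw [← ofReal_measureReal]
  exact ENNReal.ofReal_le_ofReal h4

/-- The tail of a linear combination of independent standard normal variables, with random
weights that are determined by an independent variable `D`. -/
theorem gaussian_sum_tail_of_indep {𝒟 : Type*} [MeasurableSpace 𝒟] {D : Ω → 𝒟}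
    (hD : Measurable D) {Z : ℕ → Ω → ℝ} (hZ : ∀ i, Measurable (Z i))
    (hlaw : ∀ i, P.map (Z i) = gaussianReal 0 1) (hind : iIndepFun Z P)
    (hDZ : IndepFun D (fun ω i => Z i ω) P) (s : Finset ℕ) {w : ℕ → 𝒟 → ℝ}
    (hw : ∀ i, Measurable (w i)) {A : Set 𝒟} (hA : MeasurableSet A) {V g : ℝ} (hg : 0 ≤ g)
    (hV : ∀ u ∈ A, ∑ i ∈ s, w i u ^ 2 ≤ V) :
    P {ω | D ω ∈ A ∧ g ≤ ∑ i ∈ s, w i (D ω) * Z i ω} ≤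
      ENNReal.ofReal (Real.exp (-g ^ 2 / (2 * V))) := by
  have hZm : Measurable (fun ω i => Z i ω) := measurable_pi_lambda _ hZ
  set G : Set (𝒟 × (ℕ → ℝ)) := {p | p.1 ∈ A ∧ g ≤ ∑ i ∈ s, w i p.1 * p.2 i} with hG
  have hGm : MeasurableSet G := by
    have hle : MeasurableSet {p : 𝒟 × (ℕ → ℝ) | g ≤ ∑ i ∈ s, w i p.1 * p.2 i} := by
      refine measurableSet_le measurable_const ?_
      refine Finset.measurable_sum _ fun i _ => ?_
      exact ((hw i).comp measurable_fst).mul ((measurable_pi_apply i).comp measurable_snd)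
    exact MeasurableSet.inter (measurable_fst hA) hle
  have h1 : P {ω | D ω ∈ A ∧ g ≤ ∑ i ∈ s, w i (D ω) * Z i ω} =
      ((P.map D).prod (P.map (fun ω i => Z i ω))) G := by
    rw [← (indepFun_iff_map_prod_eq_prod_map_map hD.aemeasurable hZm.aemeasurable).1 hDZ,
      Measure.map_apply (hD.prodMk hZm) hGm]
    rfl
  have : IsProbabilityMeasure (P.map D) := Measure.isProbabilityMeasure_map hD.aemeasurable
  have : IsProbabilityMeasure (P.map (fun ω i => Z i ω)) :=
    Measure.isProbabilityMeasure_map hZm.aemeasurable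
  -- Fubini: for each fixed design value the weights are constants and the deterministic bound
  -- applies.
  rw [h1, Measure.prod_apply hGm]
  refine (lintegral_mono (g := fun _ => ENNReal.ofReal (Real.exp (-g ^ 2 / (2 * V))))
    fun u => ?_).trans (by simp)
  by_cases hu : u ∈ A
  · rw [Measure.map_apply hZm (measurable_prodMk_left hGm)]
    refine (measure_mono ?_).trans (gaussian_sum_tail hZ hlaw hind s (fun i => w i u) (hV u hu) hg)
    intro ω hω
    exact hω.2
  · have : Prod.mk u ⁻¹' G = ∅ := by
      ext v; simp [hG, hu]
    rw [this]; simp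

open Classical in
/-- A Chernoff bound for the lower tail of the number of successes. -/
theorem chernoff_lower_tail {β : Type*} [MeasurableSpace β] {D : ℕ → Ω → β}
    (hD : ∀ i, Measurable (D i)) (hind : iIndepFun D P) {B : Set β} (hB : MeasurableSet B)
    {q θ : ℝ} (hθ : 0 ≤ θ) (hq : ∀ i, q ≤ P.real (D i ⁻¹' B)) (t m : ℕ) :
    P {ω | ((Finset.range t).filter (fun i => D i ω ∈ B)).card ≤ m} ≤
      ENNReal.ofReal (Real.exp (θ * m - t * q * (1 - Real.exp (-θ)))) := by
  set u : β → ℝ := B.indicator 1 with hu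
  have hum : Measurable u := measurable_one.indicator hB
  set K : ℕ → Ω → ℝ := fun i => u ∘ D i with hK
  have hKm : ∀ i, Measurable (K i) := fun i => hum.comp (hD i)
  have hKind : iIndepFun K P := hind.comp (fun _ => u) (fun _ => hum)
  have hcard : ∀ ω, (((Finset.range t).filter (fun i => D i ω ∈ B)).card : ℝ) =
      (∑ i ∈ Finset.range t, K i) ω := by
    intro ω
    rw [Finset.sum_apply, Finset.card_filter]
    push_cast
    refine Finset.sum_congr rfl fun i _ => ?_
    simp [hK, hu, Set.indicator_apply]
  -- `K i` takes only the values 0 and 1, so its exponential is affine in the indicator. The moment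
  -- generating function is then bounded by 1 - u ≤ e^(-u).
  have hexp : ∀ i ω, Real.exp (-θ * K i ω) =
      1 - (1 - Real.exp (-θ)) * (D i ⁻¹' B).indicator 1 ω := by
    intro i ω
    by_cases h : D i ω ∈ B <;> simp [hK, hu, h]
  have hmgf : ∀ i, mgf (K i) P (-θ) ≤ Real.exp (-(q * (1 - Real.exp (-θ)))) := by
    intro i
    have hint : Integrable ((D i ⁻¹' B).indicator (1 : Ω → ℝ)) P :=
      (integrable_const (1 : ℝ)).indicator (hD i hB)
    rw [mgf]
    simp_rw [hexp i]
    rw [integral_sub (integrable_const _) (hint.const_mul _), integral_const_mul,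
      integral_indicator_one (hD i hB)]
    simp only [integral_const, probReal_univ, smul_eq_mul, mul_one]
    have h0 : 0 ≤ 1 - Real.exp (-θ) := by
      have := Real.exp_le_one_iff.2 (neg_nonpos.2 hθ)
      linarith
    have h1 := mul_le_mul_of_nonneg_left (hq i) h0
    have h2 := Real.add_one_le_exp (-(q * (1 - Real.exp (-θ))))
    linarith
  have hint : Integrable (fun ω => Real.exp (-θ * (∑ i ∈ Finset.range t, K i) ω)) P := by
    refine Integrable.of_bound (C := 1) ?_ (ae_of_all _ fun ω => ?_)
    · refine (Measurable.exp (Measurable.const_mul ?_ _)).aestronglyMeasurable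
      have : Measurable (fun ω => ∑ i ∈ Finset.range t, K i ω) :=
        Finset.measurable_sum _ fun i _ => hKm i
      convert this using 1
      ext ω
      simp
    · rw [Real.norm_eq_abs, Real.abs_exp, Real.exp_le_one_iff, ← hcard]
      have : 0 ≤ θ * (((Finset.range t).filter (fun i => D i ω ∈ B)).card : ℝ) := by positivity
      linarith
  have h1 := measure_le_le_exp_mul_mgf (μ := P) (X := ∑ i ∈ Finset.range t, K i) (t := -θ)
    (m : ℝ) (by linarith) hint
  rw [hKind.mgf_sum hKm] at h1
  have h2 : ∏ i ∈ Finset.range t, mgf (K i) P (-θ) ≤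
      Real.exp (-(q * (1 - Real.exp (-θ)))) ^ t := by
    refine (Finset.prod_le_prod (fun i _ => mgf_nonneg) (fun i _ => hmgf i)).trans ?_
    simp
  rw [← ofReal_measureReal]
  refine ENNReal.ofReal_le_ofReal ?_
  have h3 : {ω | ((Finset.range t).filter (fun i => D i ω ∈ B)).card ≤ m} =
      {ω | (∑ i ∈ Finset.range t, K i) ω ≤ (m : ℝ)} := by
    ext ω
    simp only [Set.mem_ofPred_eq, ← hcard, Nat.cast_le]
  rw [h3]
  refine h1.trans ((mul_le_mul_of_nonneg_left h2 (Real.exp_pos _).le).trans_eq ?_)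
  rw [← Real.exp_nat_mul, ← Real.exp_add]
  congr 1
  ring

end probability

/-! ### Radii and volumes of the neighborhoods -/

theorem radius_nonneg {d : ℕ} {c ξ : ℝ} (hc : 0 < c) (m : ℕ) : 0 ≤ radius d c ξ m :=
  mul_nonneg hc.le (Real.rpow_nonneg (Nat.cast_nonneg m) _)

/-- The exponent is nonpositive. The condition `1 ≤ k` excludes the default value: for `d > 0` the
real power makes the radius at 0 equal to 0. -/
theorem radius_anti {d : ℕ} {c ξ : ℝ} (hc : 0 < c) (hξ : 0 < ξ) {k m : ℕ} (hk : 1 ≤ k)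
    (hkm : k ≤ m) : radius d c ξ m ≤ radius d c ξ k := by
  refine mul_le_mul_of_nonneg_left ?_ hc.le
  refine Real.rpow_le_rpow_of_nonpos (by exact_mod_cast hk) (by exact_mod_cast hkm) ?_
  exact div_nonpos_of_nonpos_of_nonneg (by linarith) (Nat.cast_nonneg d)

theorem radius_pow {d : ℕ} (hd : 0 < d) (c ξ : ℝ) (m : ℕ) :
    radius d c ξ m ^ d = c ^ d * (m : ℝ) ^ (-ξ) := by
  have hd' : (d : ℝ) ≠ 0 := by exact_mod_cast hd.ne'
  rw [radius, mul_pow, ← Real.rpow_mul_natCast (Nat.cast_nonneg m), div_mul_cancel₀ _ hd']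

/-- Taking `ξ/d` in the radius makes the volume decay as `m^(-ξ)` in every dimension, which is why
the rate exponent does not involve `d`. -/
theorem volume_ball_radius {d : ℕ} (hd : 0 < d) {c ξ : ℝ} (hc : 0 < c) (m : ℕ)
    (y : EuclideanSpace ℝ (Fin d)) :
    volume (Metric.ball y (radius d c ξ m)) =
      ENNReal.ofReal (volConst d c * (m : ℝ) ^ (-ξ)) := by
  have : Nonempty (Fin d) := ⟨⟨0, hd⟩⟩
  rw [EuclideanSpace.volume_ball, Fintype.card_fin,
    ← ENNReal.ofReal_pow (radius_nonneg hc m), ← ENNReal.ofReal_mul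
      (pow_nonneg (radius_nonneg hc m) _), radius_pow hd, volConst, Real.sqrt_eq_rpow,
    ← Real.rpow_mul_natCast Real.pi_pos.le, one_div_mul_eq_div]
  congr 1
  ring

theorem volConst_pos (d : ℕ) {c : ℝ} (hc : 0 < c) : 0 < volConst d c := by
  have : 0 < Real.Gamma ((d : ℝ) / 2 + 1) := Real.Gamma_pos_of_pos (by positivity)
  have := Real.rpow_pos_of_pos Real.pi_pos ((d : ℝ) / 2)
  unfold volConst
  positivity

/-! ### Bias and noise of an estimate -/

section weights

variable {χ : Type*} {d : ℕ}

open Classical in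
/-- The coefficient of the noise of run `i` in the estimate of `f_x(y)` on stage `t`. -/
noncomputable def noiseWeight (Y : Set (EuclideanSpace ℝ (Fin d))) (c ξ : ℝ)
    (σ : χ → EuclideanSpace ℝ (Fin d) → ℝ) (xs : ℕ → χ) (ys : ℕ → EuclideanSpace ℝ (Fin d))
    (x : χ) (y : EuclideanSpace ℝ (Fin d)) (t i : ℕ) : ℝ :=
  if i ∈ nbhd Y c ξ xs ys x y t then
    (interior Y).indicator (σ x) (ys i) / (psi Y c ξ xs ys x y t : ℝ) else 0

variable {Y : Set (EuclideanSpace ℝ (Fin d))} {c ξ : ℝ}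
  {f σ : χ → EuclideanSpace ℝ (Fin d) → ℝ}
  {xs : ℕ → χ} {ys : ℕ → EuclideanSpace ℝ (Fin d)} {x : χ} {y : EuclideanSpace ℝ (Fin d)}
  {t k : ℕ}

/-- Since radii decrease, the random radius at `Ψ ≥ k` may be replaced by the deterministic one at
`k`. -/
theorem nbhd_spec (hc : 0 < c) (hξ : 0 < ξ) (hk : 1 ≤ k) (hkψ : k ≤ psi Y c ξ xs ys x y t) {i : ℕ}
    (hi : i ∈ nbhd Y c ξ xs ys x y t) :
    i < t ∧ xs i = x ∧ ‖ys i - y‖ < radius d c ξ k ∧ ys i ∈ interior Y := by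
  have h := mem_mSet.1 (nbhd_subset hi)
  exact ⟨h.1, h.2.1, h.2.2.1.trans_le (radius_anti hc hξ hk hkψ), h.2.2.2⟩

theorem nbhd_subset_range : nbhd Y c ξ xs ys x y t ⊆ Finset.range t :=
  nbhd_subset.trans mSet_subset_range

/-- There are exactly Ψ nontrivial summands, each at most (s/Ψ)², so the sum is at most s²/Ψ ≤ s²/k.
This is the conditional variance of the estimate. -/
theorem sum_sq_noiseWeight_le (hc : 0 < c) (hξ : 0 < ξ) (hk : 1 ≤ k)
    (hkψ : k ≤ psi Y c ξ xs ys x y t) {s : ℝ}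
    (hσ : ∀ z ∈ interior Y, ‖z - y‖ < radius d c ξ k → 0 ≤ σ x z ∧ σ x z ≤ s) :
    ∑ i ∈ Finset.range t, noiseWeight Y c ξ σ xs ys x y t i ^ 2 ≤ s ^ 2 / k := by
  classical
  have hk0 : (0 : ℝ) < k := by exact_mod_cast hk
  have hψ : (k : ℝ) ≤ psi Y c ξ xs ys x y t := by exact_mod_cast hkψ
  have hψ0 : (0 : ℝ) < psi Y c ξ xs ys x y t := hk0.trans_le hψ
  have h1 : ∀ i ∈ nbhd Y c ξ xs ys x y t, noiseWeight Y c ξ σ xs ys x y t i ^ 2 ≤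
      s ^ 2 / (psi Y c ξ xs ys x y t : ℝ) ^ 2 := by
    intro i hi
    have h := nbhd_spec hc hξ hk hkψ hi
    rw [noiseWeight, if_pos hi, Set.indicator_of_mem h.2.2.2, div_pow]
    have h' := hσ _ h.2.2.2 h.2.2.1
    gcongr
    · exact h'.1
    · exact h'.2
  have h2 : ∑ i ∈ Finset.range t, noiseWeight Y c ξ σ xs ys x y t i ^ 2 =
      ∑ i ∈ nbhd Y c ξ xs ys x y t, noiseWeight Y c ξ σ xs ys x y t i ^ 2 := by
    refine (Finset.sum_subset nbhd_subset_range fun i _ hi => ?_).symm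
    simp [noiseWeight, hi]
  rw [h2]
  refine (Finset.sum_le_card_nsmul _ _ _ h1).trans ?_
  rw [activation_spec.2, nsmul_eq_mul]
  have : (psi Y c ξ xs ys x y t : ℝ) * (s ^ 2 / (psi Y c ξ xs ys x y t : ℝ) ^ 2) =
      s ^ 2 / psi Y c ξ xs ys x y t := by
    field_simp
  rw [this]
  gcongr

/-- Once the noise is removed, what remains is an average of values of `f x` at sampled contexts,
each within η of `v`. -/
theorem abs_fhat_sub_le (hc : 0 < c) (hξ : 0 < ξ) (hk : 1 ≤ k)
    (hkψ : k ≤ psi Y c ξ xs ys x y t) {v η : ℝ}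
    (hf : ∀ z ∈ interior Y, ‖z - y‖ < radius d c ξ k → |f x z - v| ≤ η) (zs : ℕ → ℝ) :
    |fhat Y c ξ xs ys (fun i => f (xs i) (ys i) + σ (xs i) (ys i) * zs i) x y t - v -
      ∑ i ∈ Finset.range t, noiseWeight Y c ξ σ xs ys x y t i * zs i| ≤ η := by
  classical
  have hψ0 : (0 : ℝ) < psi Y c ξ xs ys x y t := by exact_mod_cast (hk.trans hkψ)
  have h2 : ∑ i ∈ Finset.range t, noiseWeight Y c ξ σ xs ys x y t i * zs i =
      (1 / (psi Y c ξ xs ys x y t : ℝ)) *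
        ∑ i ∈ nbhd Y c ξ xs ys x y t, σ (xs i) (ys i) * zs i := by
    have h4 : ∑ i ∈ nbhd Y c ξ xs ys x y t, noiseWeight Y c ξ σ xs ys x y t i * zs i =
        ∑ i ∈ Finset.range t, noiseWeight Y c ξ σ xs ys x y t i * zs i :=
      Finset.sum_subset nbhd_subset_range fun i _ hi => by simp [noiseWeight, hi]
    rw [Finset.mul_sum, ← h4]
    refine Finset.sum_congr rfl fun i hi => ?_
    have h := nbhd_spec hc hξ hk hkψ hi
    rw [noiseWeight, if_pos hi, Set.indicator_of_mem h.2.2.2, h.2.1]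
    ring
  have h3 : fhat Y c ξ xs ys (fun i => f (xs i) (ys i) + σ (xs i) (ys i) * zs i) x y t - v -
      ∑ i ∈ Finset.range t, noiseWeight Y c ξ σ xs ys x y t i * zs i =
      (1 / (psi Y c ξ xs ys x y t : ℝ)) *
        ∑ i ∈ nbhd Y c ξ xs ys x y t, (f (xs i) (ys i) - v) := by
    rw [h2, fhat, Finset.sum_add_distrib, Finset.sum_sub_distrib, Finset.sum_const,
      activation_spec.2, nsmul_eq_mul]
    field_simp
    ring
  rw [h3, abs_mul, abs_of_pos (by positivity), one_div, inv_mul_le_iff₀ hψ0]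
  refine (Finset.abs_sum_le_sum_abs _ _).trans ?_
  refine (Finset.sum_le_card_nsmul _ _ η fun i hi => ?_).trans_eq ?_
  · have h := nbhd_spec hc hξ hk hkψ hi
    rw [h.2.1]
    exact hf _ h.2.2.2 h.2.2.1
  · rw [activation_spec.2, nsmul_eq_mul]

/-- A run samples only one decision, so distinct decisions use disjoint samples and their variances
add without a cross term. -/
theorem noiseWeight_mul_eq_zero {x' : χ} (hx : x ≠ x') (i : ℕ) :
    noiseWeight Y c ξ σ xs ys x y t i * noiseWeight Y c ξ σ xs ys x' y t i = 0 := by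
  classical
  by_cases h : i ∈ nbhd Y c ξ xs ys x y t
  · have h' : i ∉ nbhd Y c ξ xs ys x' y t := fun h' =>
      hx ((mem_mSet.1 (nbhd_subset h)).2.1.symm.trans (mem_mSet.1 (nbhd_subset h')).2.1)
    simp [noiseWeight, h']
  · simp [noiseWeight, h]

end weights

/-! ### Measurability in the design -/

section measurability

variable {χ : Type*} [MeasurableSpace χ] [DiscreteMeasurableSpace χ] {d : ℕ}
  {Y : Set (EuclideanSpace ℝ (Fin d))} {c ξ : ℝ} {σ : χ → EuclideanSpace ℝ (Fin d) → ℝ}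

/-- The set of the pairs `(x, z)` that count for the `m`-set at `(x, y)` is measurable. -/
theorem measurableSet_mSet_cond (x : χ) (y : EuclideanSpace ℝ (Fin d)) (m : ℕ) :
    MeasurableSet {p : χ × EuclideanSpace ℝ (Fin d) |
      p.1 = x ∧ ‖p.2 - y‖ < radius d c ξ m ∧ p.2 ∈ interior Y} := by
  refine (measurable_fst (MeasurableSet.of_discrete (s := {x}))).inter
    (MeasurableSet.inter ?_ (measurable_snd isOpen_interior.measurableSet))
  exact measurableSet_lt ((measurable_snd.sub_const y).norm) measurable_const

/-- A function of the design that is determined by the `m`-sets is measurable. -/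
theorem measurable_of_mSet_congr {γ : Type*} [MeasurableSpace γ]
    {F : (ℕ → χ × EuclideanSpace ℝ (Fin d)) → γ} (x : χ) (y : EuclideanSpace ℝ (Fin d)) (t : ℕ)
    (hF : ∀ u u' : ℕ → χ × EuclideanSpace ℝ (Fin d),
      (∀ m ≤ t, mSet Y c ξ (fun i => (u i).1) (fun i => (u i).2) x y m t =
        mSet Y c ξ (fun i => (u' i).1) (fun i => (u' i).2) x y m t) → F u = F u') :
    Measurable F := by
  -- `T` is the finite table of memberships in the `m`-sets. `F` factors through it, and every
  -- subset of its finite target is measurable.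
  set T : (ℕ → χ × EuclideanSpace ℝ (Fin d)) → (Fin (t + 1) → Fin t → Prop) :=
    fun u m i => (i : ℕ) ∈ mSet Y c ξ (fun i => (u i).1) (fun i => (u i).2) x y m t with hT
  have hTm : Measurable T := by
    refine measurable_pi_lambda _ fun m => measurable_pi_lambda _ fun i => ?_
    refine measurableSet_setOfPred.1 ?_
    have hp : Measurable fun u : ℕ → χ × EuclideanSpace ℝ (Fin d) => u i := measurable_pi_apply _
    have := hp (measurableSet_mSet_cond (Y := Y) (c := c) (ξ := ξ) x y m)
    convert this using 1
    ext u
    simp [hT, mem_mSet]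
  have hTF : ∀ u u', T u = T u' → F u = F u' := by
    intro u u' h
    refine hF u u' fun m hm => ?_
    ext i
    by_cases hi : i < t
    · exact (congrFun (congrFun h ⟨m, Nat.lt_succ_of_le hm⟩) ⟨i, hi⟩).to_iff
    · rw [mem_mSet, mem_mSet]
      simp [hi]
  intro s _
  have : F ⁻¹' s = T ⁻¹' (T '' (F ⁻¹' s)) := by
    refine Set.Subset.antisymm (Set.subset_preimage_image _ _) ?_
    rintro u ⟨u', hu', h⟩
    rw [Set.mem_preimage, ← hTF _ _ h]
    exact hu'
  rw [this]
  exact hTm MeasurableSet.of_discrete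

/-- The indicator in `noiseWeight` is there for this: `σ x` is controlled only on the interior,
where all neighborhood samples lie. -/
theorem measurable_noiseWeight {x : χ} (hσ : ContinuousOn (σ x) (interior Y))
    (y : EuclideanSpace ℝ (Fin d)) (t i : ℕ) :
    Measurable (fun u : ℕ → χ × EuclideanSpace ℝ (Fin d) =>
      noiseWeight Y c ξ σ (fun j => (u j).1) (fun j => (u j).2) x y t i) := by
  classical
  have h1 : MeasurableSet {u : ℕ → χ × EuclideanSpace ℝ (Fin d) |
      i ∈ nbhd Y c ξ (fun j => (u j).1) (fun j => (u j).2) x y t} := by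
    refine measurableSet_setOfPred.2 (measurable_of_mSet_congr (Y := Y) (c := c) (ξ := ξ) x y t ?_)
    intro u u' h
    rw [(nbhd_congr h).2]
  have h2 : Measurable fun u : ℕ → χ × EuclideanSpace ℝ (Fin d) =>
      (psi Y c ξ (fun j => (u j).1) (fun j => (u j).2) x y t : ℝ) := by
    refine measurable_of_mSet_congr (Y := Y) (c := c) (ξ := ξ) x y t ?_
    intro u u' h
    rw [(nbhd_congr h).1]
  have h3 : Measurable ((interior Y).indicator (σ x)) := by
    rw [← Set.piecewise_eq_indicator]
    exact hσ.measurable_piecewise continuousOn_const isOpen_interior.measurableSet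
  unfold noiseWeight
  exact Measurable.ite h1 ((h3.comp (measurable_snd.comp (measurable_pi_apply i))).div h2)
    measurable_const

end measurability

/-! ### The two error events: few hits and misordered estimates -/

section bounds

variable {χ : Type*} [MeasurableSpace χ] [DiscreteMeasurableSpace χ] {d : ℕ}
  {Y : Set (EuclideanSpace ℝ (Fin d))} {c ξ : ℝ} {f σ a : χ → EuclideanSpace ℝ (Fin d) → ℝ}
  {Ω : Type*} [MeasurableSpace Ω] {P : Measure Ω} [IsProbabilityMeasure P]
  {X : ℕ → Ω → χ} {S : ℕ → Ω → EuclideanSpace ℝ (Fin d)} {Z : ℕ → Ω → ℝ}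

/-- The probability that few runs hit a small neighborhood. -/
theorem prob_psi_lt_le (hd : 0 < d) (hc : 0 < c) (hsamp : IsStaticSampling Y a P X S Z) {x : χ}
    {y : EuclideanSpace ℝ (Fin d)} {β θ : ℝ} (hβ : 0 ≤ β) (hθ : 0 ≤ θ) {m : ℕ}
    (ha : ∀ z, ‖z - y‖ < radius d c ξ m → z ∈ interior Y ∧ β ≤ a x z) (t : ℕ) :
    P {ω | psi Y c ξ (fun i => X i ω) (fun i => S i ω) x y t < m} ≤
      ENNReal.ofReal (Real.exp (θ * m -
        t * (β * (volConst d c * (m : ℝ) ^ (-ξ))) * (1 - Real.exp (-θ)))) := by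
  classical
  set B : Set (χ × EuclideanSpace ℝ (Fin d)) :=
    {p | p.1 = x ∧ ‖p.2 - y‖ < radius d c ξ m ∧ p.2 ∈ interior Y} with hB
  have hBm : MeasurableSet B := measurableSet_mSet_cond x y m
  set D : ℕ → Ω → χ × EuclideanSpace ℝ (Fin d) := fun i ω => (X i ω, S i ω) with hD
  have hDm : ∀ i, Measurable (D i) := fun i => (hsamp.measurable_X i).prodMk (hsamp.measurable_S i)
  have hDind : iIndepFun D P := hsamp.indep_runs.comp (fun _ p => (p.1, p.2.1))
    (fun _ => measurable_fst.prodMk (measurable_fst.comp measurable_snd))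
  have hq : ∀ i, β * (volConst d c * (m : ℝ) ^ (-ξ)) ≤ P.real (D i ⁻¹' B) := by
    intro i
    have hV : D i ⁻¹' B = {ω | X i ω = x ∧ S i ω ∈ Metric.ball y (radius d c ξ m)} := by
      ext ω
      simp only [hB, hD, Set.mem_preimage, Set.mem_ofPred_eq, mem_ball_iff_norm]
      exact ⟨fun h => ⟨h.1, h.2.1⟩, fun h => ⟨h.1, h.2, (ha _ h.2).1⟩⟩
    rw [measureReal_def, ← ENNReal.ofReal_le_iff_le_toReal (measure_ne_top _ _), hV,
      hsamp.law_design i x _ Metric.isOpen_ball.measurableSet, ENNReal.ofReal_mul hβ,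
      ← volume_ball_radius hd hc m y, Set.inter_eq_left.2 (fun z hz =>
        (ha z (mem_ball_iff_norm.1 hz)).1), ← setLIntegral_const]
    refine setLIntegral_mono' Metric.isOpen_ball.measurableSet fun z hz => ?_
    exact ENNReal.ofReal_le_ofReal (ha z (mem_ball_iff_norm.1 hz)).2
  -- If Ψ < m, the `m`-set is not activated by stage `t`, so at most `m` runs hit the neighborhood.
  refine (measure_mono fun ω hω => ?_).trans (chernoff_lower_tail hDm hDind hBm hθ hq t m)
  by_contra hcon
  rw [Set.mem_ofPred_eq, not_le] at hcon
  refine absurd hω (not_lt.2 (le_psi ?_))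
  refine hcon.le.trans_eq ?_
  congr 1
  ext i
  simp [mem_mSet, hB, hD]

/-- The probability that two estimates from large samples are in the wrong order. -/
theorem prob_misorder_le (hc : 0 < c) (hξ : 0 < ξ) (hsamp : IsStaticSampling Y a P X S Z)
    {x x' : χ} (hxx : x ≠ x') (hσc : ∀ x, ContinuousOn (σ x) (interior Y))
    {y : EuclideanSpace ℝ (Fin d)} {v v' η s s' : ℝ} {k k' : ℕ} (hk : 1 ≤ k) (hk' : 1 ≤ k')
    (hf : ∀ z ∈ interior Y, ‖z - y‖ < radius d c ξ k → |f x z - v| ≤ η)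
    (hf' : ∀ z ∈ interior Y, ‖z - y‖ < radius d c ξ k' → |f x' z - v'| ≤ η)
    (hσ : ∀ z ∈ interior Y, ‖z - y‖ < radius d c ξ k → 0 ≤ σ x z ∧ σ x z ≤ s)
    (hσ' : ∀ z ∈ interior Y, ‖z - y‖ < radius d c ξ k' → 0 ≤ σ x' z ∧ σ x' z ≤ s')
    (hg : 0 ≤ v - v' - 2 * η) (t : ℕ) :
    P {ω | (k ≤ psi Y c ξ (fun i => X i ω) (fun i => S i ω) x y t ∧
        k' ≤ psi Y c ξ (fun i => X i ω) (fun i => S i ω) x' y t) ∧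
      fhat Y c ξ (fun i => X i ω) (fun i => S i ω) (fun i => obs f σ X S Z i ω) x y t ≤
        fhat Y c ξ (fun i => X i ω) (fun i => S i ω) (fun i => obs f σ X S Z i ω) x' y t} ≤
      ENNReal.ofReal (Real.exp (-(v - v' - 2 * η) ^ 2 / (2 * (s ^ 2 / k + s' ^ 2 / k')))) := by
  set D : ℕ → Ω → χ × EuclideanSpace ℝ (Fin d) := fun i ω => (X i ω, S i ω) with hD
  have hDm : ∀ i, Measurable (D i) := fun i => (hsamp.measurable_X i).prodMk (hsamp.measurable_S i)
  -- Independence of whole sequences is required, since the weight of one run depends on the designs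
  -- of the other runs.
  have hDZ : IndepFun (fun ω i => D i ω) (fun ω i => Z i ω) P := by
    refine indepFun_sequences hDm hsamp.measurable_Z hsamp.indep_noise ?_
    exact hsamp.indep_runs.comp (fun _ p => ((p.1, p.2.1), p.2.2))
      (fun _ => (measurable_fst.prodMk (measurable_fst.comp measurable_snd)).prodMk
        (measurable_snd.comp measurable_snd))
  have hZind : iIndepFun Z P := hsamp.indep_runs.comp (fun _ p => p.2.2)
    (fun _ => measurable_snd.comp measurable_snd)
  set W : χ → ℕ → (ℕ → χ × EuclideanSpace ℝ (Fin d)) → ℝ := fun x i u =>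
    noiseWeight Y c ξ σ (fun j => (u j).1) (fun j => (u j).2) x y t i with hW
  set A : Set (ℕ → χ × EuclideanSpace ℝ (Fin d)) :=
    {u | k ≤ psi Y c ξ (fun j => (u j).1) (fun j => (u j).2) x y t} ∩
    {u | k' ≤ psi Y c ξ (fun j => (u j).1) (fun j => (u j).2) x' y t} with hA
  have hAm : MeasurableSet A := by
    refine MeasurableSet.inter ?_ ?_
    · refine measurableSet_setOfPred.2 (measurable_of_mSet_congr (Y := Y) (c := c) (ξ := ξ) x y t ?_)
      intro u u' h
      rw [(nbhd_congr h).1]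
    · refine measurableSet_setOfPred.2 (measurable_of_mSet_congr (Y := Y) (c := c) (ξ := ξ) x' y t ?_)
      intro u u' h
      rw [(nbhd_congr h).1]
  refine (measure_mono ?_).trans (gaussian_sum_tail_of_indep (measurable_pi_lambda _ hDm)
    hsamp.measurable_Z hsamp.law_noise hZind hDZ (Finset.range t)
    (w := fun i u => W x' i u - W x i u) (fun i =>
      (measurable_noiseWeight (hσc x') y t i).sub (measurable_noiseWeight (hσc x) y t i))
    hAm hg ?_)
  -- Each bias is at most η, so a reversed order forces the noise difference to make up the gap `v -
  -- v'` up to 2η.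
  · rintro ω ⟨⟨h1, h2⟩, h3⟩
    refine ⟨⟨h1, h2⟩, ?_⟩
    have e1 := abs_le.1 (abs_fhat_sub_le (σ := σ) hc hξ hk h1 hf (fun i => Z i ω))
    have e2 := abs_le.1 (abs_fhat_sub_le (σ := σ) hc hξ hk' h2 hf' (fun i => Z i ω))
    simp only [sub_mul, Finset.sum_sub_distrib, hW]
    simp only [obs] at h3
    linarith [e1.1, e2.2]
  · rintro u ⟨h1, h2⟩
    have e1 := sum_sq_noiseWeight_le hc hξ hk h1 hσ
    have e2 := sum_sq_noiseWeight_le hc hξ hk' h2 hσ'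
    have e3 : ∀ i, (W x' i u - W x i u) ^ 2 = W x i u ^ 2 + W x' i u ^ 2 := by
      intro i
      have := noiseWeight_mul_eq_zero (Y := Y) (c := c) (ξ := ξ) (σ := σ)
        (xs := fun j => (u j).1) (ys := fun j => (u j).2) (y := y) (t := t) hxx i
      simp only [hW]
      linear_combination (-2) * this
    simp only [e3, Finset.sum_add_distrib]
    exact add_le_add e1 e2

end bounds

/-! ### Asymptotics of the Chernoff exponent -/

theorem tendsto_natCast_rpow_atTop {p : ℝ} (hp : 0 < p) :
    Tendsto (fun t : ℕ => (t : ℝ) ^ p) atTop atTop :=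
  (tendsto_rpow_atTop hp).comp tendsto_natCast_atTop_atTop

/-- With `m = ⌈κ t^p⌉` and `p = 1 / (1 + ξ)`, the exponent of the Chernoff bound is of order `t^p`. -/
theorem eventually_chernoff_exponent_le {ξ κ θ b h : ℝ} (hξ : 0 < ξ) (hκ : 0 < κ)
    (hlt : θ * κ - b * κ ^ (-ξ) < -h) :
    ∀ᶠ t : ℕ in atTop, θ * (⌈κ * (t : ℝ) ^ (1 / (1 + ξ))⌉₊ : ℝ) -
      t * b * (⌈κ * (t : ℝ) ^ (1 / (1 + ξ))⌉₊ : ℝ) ^ (-ξ) ≤ -h * (t : ℝ) ^ (1 / (1 + ξ)) := by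
  have hp : 0 < 1 / (1 + ξ) := by positivity
  have h1 : Tendsto (fun t : ℕ => (⌈κ * (t : ℝ) ^ (1 / (1 + ξ))⌉₊ : ℝ) / (t : ℝ) ^ (1 / (1 + ξ)))
      atTop (𝓝 κ) := (tendsto_nat_ceil_mul_div_atTop hκ.le).comp (tendsto_natCast_rpow_atTop hp)
  have h2 := (h1.const_mul θ).sub ((h1.rpow_const (p := -ξ) (Or.inl hκ.ne')).const_mul b)
  filter_upwards [h2.eventually_lt_const hlt, eventually_gt_atTop 0] with t ht ht0
  have ht0' : (0 : ℝ) < t := by exact_mod_cast ht0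
  set T : ℝ := (t : ℝ) ^ (1 / (1 + ξ)) with hT
  have hT0 : 0 < T := Real.rpow_pos_of_pos ht0' _
  set m : ℝ := (⌈κ * T⌉₊ : ℝ) with hm
  -- The exponent 1/(1+ξ) is chosen so that t = T^(1+ξ). Then t m^(-ξ) = T (m/T)^(-ξ) has the same
  -- order T as m itself.
  have hTt : (t : ℝ) = T * T ^ ξ := by
    have : T * T ^ ξ = T ^ (1 + ξ) := by rw [Real.rpow_add hT0, Real.rpow_one]
    rw [this, hT, ← Real.rpow_mul ht0'.le, one_div_mul_cancel (by positivity), Real.rpow_one]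
  have hdiv : (m / T) ^ (-ξ) = m ^ (-ξ) * T ^ ξ := by
    rw [Real.div_rpow (Nat.cast_nonneg _) hT0.le, Real.rpow_neg hT0.le ξ, div_inv_eq_mul]
  have h3 : θ * m - t * b * m ^ (-ξ) = T * (θ * (m / T) - b * (m / T) ^ (-ξ)) := by
    rw [hdiv, hTt]
    field_simp
  rw [h3, mul_comm (-h)]
  exact mul_le_mul_of_nonneg_left ht.le hT0.le

theorem tendsto_radius {d : ℕ} (hd : 0 < d) (c : ℝ) {ξ : ℝ} (hξ : 0 < ξ) :
    Tendsto (radius d c ξ) atTop (𝓝 0) := by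
  have hd' : (0 : ℝ) < d := by exact_mod_cast hd
  have h := ((tendsto_rpow_neg_atTop (div_pos hξ hd')).comp
    tendsto_natCast_atTop_atTop).const_mul c
  rw [mul_zero] at h
  refine h.congr fun m => ?_
  simp [radius, neg_div]

/-! ### Optimal decisions and signal-to-noise ratios -/

section wellSeparated

variable {χ : Type*} [Finite χ] [Nontrivial χ]

theorem xstar_le {E : Type*} (f : χ → E → ℝ) (y : E) (x : χ) : f (xstar f y) y ≤ f x y :=
  Classical.choose_spec (Finite.exists_min (fun x => f x y)) x

theorem xstar_lt {E : Type*} {f : χ → E → ℝ} {Y : Set E} {y : E} (hy : y ∈ Y)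
    (hMO : y ∉ multiOpt f Y) {x : χ} (hx : x ≠ xstar f y) : f (xstar f y) y < f x y := by
  refine lt_of_not_ge fun h => hMO ⟨hy, x, xstar f y, hx, fun x' => ?_, xstar_le f y⟩
  exact h.trans (xstar_le f y x')

theorem xstar_eq {E : Type*} {f : χ → E → ℝ} {y : E} {x₀ : χ} (h : ∀ x ≠ x₀, f x₀ y < f x y) :
    xstar f y = x₀ := by
  by_contra hne
  exact absurd (xstar_le f y x₀) (not_le.2 (h _ hne))

/-- The signal-to-noise ratio of the optimal decision uses the smallest gap. -/
theorem zeta_xstar {E : Type*} (f σ : χ → E → ℝ) (y : E) :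
    (∃ x₁ ≠ xstar f y, zeta f σ (xstar f y) y =
      (f x₁ y - f (xstar f y) y) ^ 2 / (4 * σ (xstar f y) y ^ 2)) ∧
    ∀ x ≠ xstar f y, zeta f σ (xstar f y) y ≤
      (f x y - f (xstar f y) y) ^ 2 / (4 * σ (xstar f y) y ^ 2) := by
  obtain ⟨x₂, hx₂⟩ := exists_ne (xstar f y)
  have : Nonempty {x' : χ // x' ≠ xstar f y} := ⟨⟨x₂, hx₂⟩⟩
  have hz : zeta f σ (xstar f y) y = ((⨅ x' : {x' : χ // x' ≠ xstar f y}, f x'.1 y) -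
      f (xstar f y) y) ^ 2 / (4 * σ (xstar f y) y ^ 2) := by simp [zeta]
  obtain ⟨x₁, hx₁⟩ := exists_eq_ciInf_of_finite (f := fun x' : {x' : χ // x' ≠ xstar f y} => f x'.1 y)
  rw [hz]
  refine ⟨⟨x₁.1, x₁.2, by rw [← hx₁]⟩, fun x hx => ?_⟩
  rw [← hx₁]
  have h1 : f x₁.1 y ≤ f x y := by
    rw [hx₁]
    exact ciInf_le (Set.finite_range _).bddBelow (⟨x, hx⟩ : {x' : χ // x' ≠ xstar f y})
  have h2 := xstar_le f y x₁.1
  gcongr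

theorem zeta_of_ne {E : Type*} {f σ : χ → E → ℝ} {x : χ} {y : E} (hx : x ≠ xstar f y) :
    zeta f σ x y = (f x y - f (xstar f y) y) ^ 2 / (4 * σ x y ^ 2) := by
  simp [zeta, hx]

theorem zeta_pos {E : Type*} {f σ : χ → E → ℝ} {Y : Set E} {y : E} (hy : y ∈ Y)
    (hMO : y ∉ multiOpt f Y) (hσ : ∀ x, 0 < σ x y) (x : χ) : 0 < zeta f σ x y := by
  have h : ∀ x' ≠ xstar f y, ∀ x, 0 < (f x' y - f (xstar f y) y) ^ 2 / (4 * σ x y ^ 2) := by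
    intro x' hx' x
    have h1 := sub_pos.2 (xstar_lt hy hMO hx')
    have h2 := hσ x
    positivity
  by_cases hx : x = xstar f y
  · rw [hx]
    obtain ⟨⟨x₁, hx₁, he⟩, _⟩ := zeta_xstar f σ y
    rw [he]
    exact h _ hx₁ _
  · rw [zeta_of_ne hx]
    exact h _ hx _

end wellSeparated

/-! ### The balancing sample size -/

section sampleSize

variable {χ : Type*} [Finite χ] [Nontrivial χ] {d : ℕ}

/-- The number `κ` such that a sample of size `κ t^(1/(1+ξ))` balances the probability of few hits
and that of a wrong estimate. -/
noncomputable def sampleScale (c ξ : ℝ) (f σ a : χ → EuclideanSpace ℝ (Fin d) → ℝ) (x : χ)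
    (y : EuclideanSpace ℝ (Fin d)) : ℝ :=
  (volConst d c * a x y / -lambertWm1 (-Real.exp (-zeta f σ x y - 1))) ^ (1 / (1 + ξ))

variable {c ξ : ℝ} {f σ a : χ → EuclideanSpace ℝ (Fin d) → ℝ} {y : EuclideanSpace ℝ (Fin d)}

theorem sampleScale_pos (hc : 0 < c) {x : χ} (ha : 0 < a x y) (hζ : 0 < zeta f σ x y) :
    0 < sampleScale c ξ f σ a x y := by
  have h1 := (lambertWm1_spec hζ).1
  have h2 := volConst_pos d hc
  exact Real.rpow_pos_of_pos (div_pos (mul_pos h2 ha) (by linarith)) _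

/-- This identifies the terms of the rate with κζ, the form in which both error exponents are
compared with it. -/
theorem rate_term_eq (hc : 0 < c) {x : χ} (ha : 0 < a x y) (hζ : 0 < zeta f σ x y) :
    volConst d c ^ (1 / (1 + ξ)) *
      (zeta f σ x y * (-lambertWm1 (-Real.exp (-zeta f σ x y - 1))) ^ (-(1 / (1 + ξ))) *
        a x y ^ (1 / (1 + ξ))) = sampleScale c ξ f σ a x y * zeta f σ x y := by
  have h1 : 0 < -lambertWm1 (-Real.exp (-zeta f σ x y - 1)) := by linarith [(lambertWm1_spec hζ).1]
  have h2 := volConst_pos d hc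
  rw [sampleScale, Real.div_rpow (mul_pos h2 ha).le h1.le, Real.mul_rpow h2.le ha.le,
    Real.rpow_neg h1.le]
  ring

theorem rate_le (hc : 0 < c) (x : χ) (ha : 0 < a x y) (hζ : 0 < zeta f σ x y) :
    rate c ξ f σ a y ≤ sampleScale c ξ f σ a x y * zeta f σ x y := by
  rw [← rate_term_eq hc ha hζ]
  refine mul_le_mul_of_nonneg_left ?_ (Real.rpow_nonneg (volConst_pos d hc).le _)
  exact ciInf_le (Set.finite_range _).bddBelow x

/-- A tilt `θ` and a lower density `β` for which the Chernoff exponent beats `h`. -/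
theorem exists_tilt (hc : 0 < c) (hξ : 0 < ξ) {x : χ} (ha : 0 < a x y) (hζ : 0 < zeta f σ x y)
    {h : ℝ} (hh : h < rate c ξ f σ a y) :
    ∃ θ β : ℝ, 0 ≤ θ ∧ 0 ≤ β ∧ β < a x y ∧
      θ * sampleScale c ξ f σ a x y -
        β * volConst d c * (1 - Real.exp (-θ)) * sampleScale c ξ f σ a x y ^ (-ξ) < -h := by
  obtain ⟨hW1, hWe, -⟩ := lambertWm1_spec hζ
  have hκ := sampleScale_pos (ξ := ξ) hc ha hζ
  have hr := hh.trans_le (rate_le (ξ := ξ) hc x ha hζ)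
  have hC := volConst_pos d hc
  have hκdef : sampleScale c ξ f σ a x y ^ (1 + ξ) =
      volConst d c * a x y / -lambertWm1 (-Real.exp (-zeta f σ x y - 1)) := by
    rw [sampleScale, ← Real.rpow_mul (div_pos (mul_pos hC ha) (by linarith)).le,
      one_div_mul_cancel (by positivity), Real.rpow_one]
  set W : ℝ := -lambertWm1 (-Real.exp (-zeta f σ x y - 1)) with hW
  set κ : ℝ := sampleScale c ξ f σ a x y with hκ'
  have hW0 : 0 < W := by linarith
  have hθ : Real.exp (-Real.log W) = W⁻¹ := by rw [Real.exp_neg, Real.exp_log hW0]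
  -- The tilt log W is the optimal one, since a C = κ^(1+ξ) W. The left side is then κ (log W - W +
  -- 1) = -κζ.
  have hlim : Real.log W * κ - a x y * volConst d c * (1 - Real.exp (-Real.log W)) * κ ^ (-ξ)
      < -h := by
    have e1 : a x y * volConst d c = κ ^ (1 + ξ) * W := by
      rw [hκdef]; field_simp
    have e2 : κ ^ (1 + ξ) * κ ^ (-ξ) = κ := by
      rw [← Real.rpow_add hκ]; simp
    have e3 : a x y * volConst d c * (1 - Real.exp (-Real.log W)) * κ ^ (-ξ) = κ * (W - 1) := by
      rw [e1, hθ]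
      calc κ ^ (1 + ξ) * W * (1 - W⁻¹) * κ ^ (-ξ)
          = (κ ^ (1 + ξ) * κ ^ (-ξ)) * (W * (1 - W⁻¹)) := by ring
        _ = κ * (W - 1) := by rw [e2, mul_sub, mul_inv_cancel₀ hW0.ne', mul_one]
    rw [e3]
    have : κ * zeta f σ x y = κ * (W - Real.log W - 1) := by rw [hWe]; ring
    rw [this] at hr
    linarith
  -- Moving β slightly below the density keeps the strict inequality and lets β bound the density
  -- from below near the context.
  have hcont : Tendsto (fun β : ℝ => Real.log W * κ -
      β * volConst d c * (1 - Real.exp (-Real.log W)) * κ ^ (-ξ)) (𝓝[<] (a x y))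
      (𝓝 (Real.log W * κ - a x y * volConst d c * (1 - Real.exp (-Real.log W)) * κ ^ (-ξ))) := by
    refine Tendsto.mono_left (Continuous.tendsto ?_ _) nhdsWithin_le_nhds
    fun_prop
  have hlt : ∀ᶠ β in 𝓝[<] (a x y), β < a x y := self_mem_nhdsWithin
  have hpos : ∀ᶠ β in 𝓝[<] (a x y), 0 < β := nhdsWithin_le_nhds (lt_mem_nhds ha)
  obtain ⟨β, h1, h2, h3⟩ := ((hcont.eventually_lt_const hlim).and (hlt.and hpos)).exists
  exact ⟨Real.log W, β, Real.log_nonneg hW1.le, le_of_lt h3, h2, h1⟩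

/-- For small `η` the Gaussian exponent beats `h`. -/
theorem eventually_gaussian_exponent {Y : Set (EuclideanSpace ℝ (Fin d))} (hc : 0 < c)
    (hy : y ∈ Y) (hMO : y ∉ multiOpt f Y) (hσ : ∀ x, 0 < σ x y) (ha : ∀ x, 0 < a x y)
    {h : ℝ} (hh : h < rate c ξ f σ a y) {x : χ} (hx : x ≠ xstar f y) :
    ∀ᶠ η in 𝓝[>] (0 : ℝ), 0 < f x y - f (xstar f y) y - 2 * η ∧
      h < (f x y - f (xstar f y) y - 2 * η) ^ 2 /
        (2 * ((σ x y + η) ^ 2 / sampleScale c ξ f σ a x y +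
          (σ (xstar f y) y + η) ^ 2 / sampleScale c ξ f σ a (xstar f y) y)) := by
  have hζ := zeta_pos hy hMO hσ
  have hκ := fun x => sampleScale_pos (ξ := ξ) hc (ha x) (hζ x)
  have hr := fun x => hh.trans_le (rate_le (ξ := ξ) hc x (ha x) (hζ x))
  have hΔ := sub_pos.2 (xstar_lt hy hMO hx)
  have z1 := zeta_of_ne (σ := σ) hx
  have z2 := (zeta_xstar f σ y).2 x hx
  set x₀ := xstar f y with hx₀
  set Δ := f x y - f x₀ y with hΔdef
  have hs := hσ x
  have hs₀ := hσ x₀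
  have hden : 0 < 2 * ((σ x y + 0) ^ 2 / sampleScale c ξ f σ a x y +
      (σ x₀ y + 0) ^ 2 / sampleScale c ξ f σ a x₀ y) := by
    have := hκ x
    have := hκ x₀
    positivity
  have hlim : h < (Δ - 2 * 0) ^ 2 / (2 * ((σ x y + 0) ^ 2 / sampleScale c ξ f σ a x y +
      (σ x₀ y + 0) ^ 2 / sampleScale c ξ f σ a x₀ y)) := by
    rw [lt_div_iff₀ hden]
    simp only [add_zero, mul_zero, sub_zero]
    -- Each of the two variance terms takes at most half of the budget Δ²/(2h); the factor 4 in ζ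
    -- comes from this split. The optimal decision qualifies for every competitor because its ζ uses
    -- the smallest gap.
    have b : ∀ x', zeta f σ x' y ≤ Δ ^ 2 / (4 * σ x' y ^ 2) → 0 < h →
        h * (σ x' y ^ 2 / sampleScale c ξ f σ a x' y) < Δ ^ 2 / 4 := by
      intro x' hz hpos
      have k1 := hκ x'
      have k2 := hσ x'
      rw [← mul_div_assoc, div_lt_iff₀ k1]
      rw [le_div_iff₀ (by positivity)] at hz
      have k3 := mul_lt_mul_of_pos_right (hr x') (pow_pos k2 2)
      have k4 := mul_le_mul_of_nonneg_left hz k1.le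
      linarith
    rcases le_or_gt h 0 with h0 | h0
    · have : 0 < Δ ^ 2 := by positivity
      simp only [add_zero] at hden
      nlinarith [mul_nonneg (neg_nonneg.2 h0) hden.le]
    · linarith [b x z1.le h0, b x₀ z2 h0]
  have hcont : Tendsto (fun η : ℝ => (Δ - 2 * η) ^ 2 /
      (2 * ((σ x y + η) ^ 2 / sampleScale c ξ f σ a x y +
        (σ x₀ y + η) ^ 2 / sampleScale c ξ f σ a x₀ y))) (𝓝[>] 0)
      (𝓝 ((Δ - 2 * 0) ^ 2 / (2 * ((σ x y + 0) ^ 2 / sampleScale c ξ f σ a x y +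
      (σ x₀ y + 0) ^ 2 / sampleScale c ξ f σ a x₀ y)))) := by
    refine Tendsto.mono_left (ContinuousAt.tendsto ?_) nhdsWithin_le_nhds
    refine ContinuousAt.div (by fun_prop) (by fun_prop) hden.ne'
  have hcont2 : Tendsto (fun η : ℝ => Δ - 2 * η) (𝓝[>] 0) (𝓝 (Δ - 2 * 0)) := by
    refine Tendsto.mono_left (Continuous.tendsto ?_ _) nhdsWithin_le_nhds
    fun_prop
  exact (hcont2.eventually_const_lt (by simpa using hΔ)).and (hcont.eventually_const_lt hlim)

end sampleSize

/-! ### Local uniform bound for wrong decisions -/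

section decisions

variable {χ : Type*} [Finite χ] [Nontrivial χ] [MeasurableSpace χ] [DiscreteMeasurableSpace χ]
  {d : ℕ} {Y : Set (EuclideanSpace ℝ (Fin d))} {c ξ : ℝ}
  {f σ a : χ → EuclideanSpace ℝ (Fin d) → ℝ}
  {Ω : Type*} [MeasurableSpace Ω] {P : Measure Ω} [IsProbabilityMeasure P]
  {X : ℕ → Ω → χ} {S : ℕ → Ω → EuclideanSpace ℝ (Fin d)} {Z : ℕ → Ω → ℝ}
  {xhat : ℕ → Ω → EuclideanSpace ℝ (Fin d) → χ}

/-- Near a context with a single optimal decision, wrong decisions are exponentially unlikely. -/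
theorem exists_nhds_prob_wrong_le (hd : 0 < d) (hfc : ∀ x, ContinuousOn (f x) (interior Y))
    (hσpos : ∀ x, ∀ y ∈ interior Y, 0 < σ x y) (hσc : ∀ x, ContinuousOn (σ x) (interior Y))
    (hapos : ∀ x, ∀ y ∈ interior Y, 0 < a x y) (hac : ∀ x, ContinuousOn (a x) (interior Y))
    (hc : 0 < c) (hξ : 0 < ξ) (hsamp : IsStaticSampling Y a P X S Z)
    (hxhat : IsInferred Y c ξ f σ X S Z xhat) {y₀ : EuclideanSpace ℝ (Fin d)}
    (hy₀ : y₀ ∈ interior Y) (hMO : y₀ ∉ multiOpt f Y) {h : ℝ} (hh : h < rate c ξ f σ a y₀) :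
    ∃ U ∈ 𝓝 y₀, ∀ᶠ t : ℕ in atTop, ∀ y ∈ U,
      P {ω | xhat t ω y ≠ xstar f y} ≤
        2 * Nat.card χ * ENNReal.ofReal (Real.exp (-h * (t : ℝ) ^ (1 / (1 + ξ)))) := by
  have := Fintype.ofFinite χ
  have hy₀Y := interior_subset hy₀
  have hs := fun x => hσpos x y₀ hy₀
  have ha := fun x => hapos x y₀ hy₀
  have hζ := zeta_pos hy₀Y hMO hs
  have hκ := fun x => sampleScale_pos (ξ := ξ) hc (ha x) (hζ x)
  choose θ β hθ hβ hβa hexp using fun x => exists_tilt hc hξ (ha x) (hζ x) hh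
  set x₀ := xstar f y₀ with hx₀
  set κ : χ → ℝ := fun x => sampleScale c ξ f σ a x y₀ with hκdef
  -- the tolerance for the bias
  obtain ⟨η, hη0, hη⟩ : ∃ η : ℝ, 0 < η ∧ ∀ x, x ≠ x₀ → 0 < f x y₀ - f x₀ y₀ - 2 * η ∧
      h < (f x y₀ - f x₀ y₀ - 2 * η) ^ 2 /
        (2 * ((σ x y₀ + η) ^ 2 / κ x + (σ x₀ y₀ + η) ^ 2 / κ x₀)) := by
    have h1 : ∀ᶠ η in 𝓝[>] (0 : ℝ), 0 < η := self_mem_nhdsWithin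
    have h2 : ∀ᶠ η in 𝓝[>] (0 : ℝ), ∀ x, x ≠ x₀ → 0 < f x y₀ - f x₀ y₀ - 2 * η ∧
        h < (f x y₀ - f x₀ y₀ - 2 * η) ^ 2 /
          (2 * ((σ x y₀ + η) ^ 2 / κ x + (σ x₀ y₀ + η) ^ 2 / κ x₀)) := by
      refine eventually_all.2 fun x => ?_
      by_cases hx : x = x₀
      · exact Eventually.of_forall fun _ h => absurd hx h
      · filter_upwards [eventually_gaussian_exponent hc hy₀Y hMO hs ha hh hx] with η h3 _
        exact h3
    exact (h1.and h2).exists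
  -- the neighborhood
  have hnhds := isOpen_interior.mem_nhds hy₀
  obtain ⟨ρ, hρ0, hρ⟩ : ∃ ρ > 0, ∀ z ∈ Metric.ball y₀ ρ, z ∈ interior Y ∧
      ∀ x, |f x z - f x y₀| ≤ η ∧ σ x z ≤ σ x y₀ + η ∧ β x ≤ a x z := by
    refine Metric.mem_nhds_iff.1 (Filter.inter_mem hnhds ?_)
    refine eventually_all.2 fun x => ?_
    have c1 := ((hfc x).continuousAt hnhds).eventually (Metric.ball_mem_nhds _ hη0)
    have c2 := ((hσc x).continuousAt hnhds).eventually_lt_const (lt_add_of_pos_right _ hη0)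
    have c3 := ((hac x).continuousAt hnhds).eventually_const_lt (hβa x)
    filter_upwards [c1, c2, c3] with z e1 e2 e3
    exact ⟨(Real.dist_eq _ _ ▸ (Metric.mem_ball.1 e1)).le, e2.le, e3.le⟩
  -- Half the radius leaves room for the sampling balls, of radius below ρ/2 for large `t`, around
  -- every `y` in this ball.
  refine ⟨Metric.ball y₀ (ρ / 2), Metric.ball_mem_nhds _ (by positivity), ?_⟩
  have hp : 0 < 1 / (1 + ξ) := by positivity
  -- The thresholds are computed at `y₀`, not at `y`, so that the final bound is uniform in `y`.
  set m : χ → ℕ → ℕ := fun x t => ⌈κ x * (t : ℝ) ^ (1 / (1 + ξ))⌉₊ with hm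
  have hmtop : ∀ x, Tendsto (m x) atTop atTop := fun x =>
    tendsto_nat_ceil_atTop.comp ((tendsto_natCast_rpow_atTop hp).const_mul_atTop (hκ x))
  have ev1 : ∀ᶠ t : ℕ in atTop, ∀ x, 1 ≤ m x t := eventually_all.2 fun x =>
    (hmtop x).eventually_ge_atTop 1
  have ev2 : ∀ᶠ t : ℕ in atTop, ∀ x, radius d c ξ (m x t) < ρ / 2 := eventually_all.2 fun x =>
    ((tendsto_radius hd c hξ).comp (hmtop x)).eventually_lt_const (by positivity)
  have ev3 := eventually_all.2 fun x => eventually_chernoff_exponent_le hξ (hκ x) (hexp x)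
  filter_upwards [ev1, ev2, ev3, eventually_gt_atTop 0] with t hm1 hmr hch ht0 y hy
  have hT0 : 0 < (t : ℝ) ^ (1 / (1 + ξ)) := Real.rpow_pos_of_pos (by exact_mod_cast ht0) _
  set T : ℝ := (t : ℝ) ^ (1 / (1 + ξ)) with hT
  have hball : ∀ x z, ‖z - y‖ < radius d c ξ (m x t) → z ∈ Metric.ball y₀ ρ := by
    intro x z hz
    rw [Metric.mem_ball] at hy ⊢
    rw [← dist_eq_norm] at hz
    linarith [dist_triangle z y y₀, hmr x]
  have hyρ : y ∈ Metric.ball y₀ ρ := Metric.ball_subset_ball (by linarith) hy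
  have hstar : xstar f y = x₀ := by
    refine xstar_eq fun x hx => ?_
    have e1 := abs_le.1 ((hρ y hyρ).2 x).1
    have e2 := abs_le.1 ((hρ y hyρ).2 x₀).1
    linarith [(hη x hx).1, e1.1, e2.2]
  rw [hstar]
  set E : ℝ≥0∞ := ENNReal.ofReal (Real.exp (-h * T)) with hE
  set G₁ : χ → Set Ω := fun x =>
    {ω | psi Y c ξ (fun i => X i ω) (fun i => S i ω) x y t < m x t} with hG₁
  set G₂ : χ → Set Ω := fun x => {ω | x ≠ x₀ ∧
    (m x t ≤ psi Y c ξ (fun i => X i ω) (fun i => S i ω) x y t ∧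
        m x₀ t ≤ psi Y c ξ (fun i => X i ω) (fun i => S i ω) x₀ y t) ∧
      fhat Y c ξ (fun i => X i ω) (fun i => S i ω) (fun i => obs f σ X S Z i ω) x y t ≤
        fhat Y c ξ (fun i => X i ω) (fun i => S i ω) (fun i => obs f σ X S Z i ω) x₀ y t}
    with hG₂
  have b₁ : ∀ x, P (G₁ x) ≤ E := by
    intro x
    refine (prob_psi_lt_le hd hc hsamp (hβ x) (hθ x) (fun z hz => ?_) t).trans ?_
    · have := hρ z (hball x z hz)
      exact ⟨this.1, (this.2 x).2.2⟩
    · refine ENNReal.ofReal_le_ofReal (Real.exp_le_exp.2 (le_trans (le_of_eq ?_) (hch x)))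
      simp only [hm, hκdef]
      ring
  have b₂ : ∀ x, P (G₂ x) ≤ E := by
    intro x
    by_cases hx : x = x₀
    · simp [hG₂, hx]
    have hx' := hη x hx
    refine (measure_mono fun ω hω => hω.2).trans ((prob_misorder_le hc hξ hsamp hx hσc
      (v := f x y₀) (v' := f x₀ y₀) (η := η) (s := σ x y₀ + η) (s' := σ x₀ y₀ + η) (hm1 x) (hm1 x₀)
      (fun z _ hz => ((hρ z (hball x z hz)).2 x).1)
      (fun z _ hz => ((hρ z (hball x₀ z hz)).2 x₀).1)
      (fun z hzY hz => ⟨(hσpos x z hzY).le, ((hρ z (hball x z hz)).2 x).2.1⟩)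
      (fun z hzY hz => ⟨(hσpos x₀ z hzY).le, ((hρ z (hball x₀ z hz)).2 x₀).2.1⟩)
      hx'.1.le t).trans ?_)
    refine ENNReal.ofReal_le_ofReal (Real.exp_le_exp.2 ?_)
    have hmpos : ∀ x, (0 : ℝ) < m x t := fun x => by exact_mod_cast hm1 x
    have hle : ∀ x, (σ x y₀ + η) ^ 2 / (m x t : ℝ) ≤ (σ x y₀ + η) ^ 2 / κ x / T := by
      intro x
      rw [div_div]
      exact div_le_div_of_nonneg_left (sq_nonneg _) (mul_pos (hκ x) hT0) (Nat.le_ceil _)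
    have hVpos : 0 < (σ x y₀ + η) ^ 2 / (m x t : ℝ) + (σ x₀ y₀ + η) ^ 2 / (m x₀ t : ℝ) := by
      have := hmpos x
      have := hmpos x₀
      have := hs x
      have := hs x₀
      positivity
    have hV0 : 0 < (σ x y₀ + η) ^ 2 / κ x + (σ x₀ y₀ + η) ^ 2 / κ x₀ := by
      have := hκ x
      have := hκ x₀
      have := hs x
      have := hs x₀
      positivity
    have hV : (σ x y₀ + η) ^ 2 / (m x t : ℝ) + (σ x₀ y₀ + η) ^ 2 / (m x₀ t : ℝ) ≤
        ((σ x y₀ + η) ^ 2 / κ x + (σ x₀ y₀ + η) ^ 2 / κ x₀) / T := by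
      rw [add_div]
      exact add_le_add (hle x) (hle x₀)
    rw [neg_div, neg_mul, neg_le_neg_iff]
    have k1 : (f x y₀ - f x₀ y₀ - 2 * η) ^ 2 /
        (2 * (((σ x y₀ + η) ^ 2 / κ x + (σ x₀ y₀ + η) ^ 2 / κ x₀) / T)) ≤
        (f x y₀ - f x₀ y₀ - 2 * η) ^ 2 /
        (2 * ((σ x y₀ + η) ^ 2 / (m x t : ℝ) + (σ x₀ y₀ + η) ^ 2 / (m x₀ t : ℝ))) := by
      gcongr
    refine le_trans ?_ k1
    have k2 := mul_le_mul_of_nonneg_right hx'.2.le hT0.le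
    refine k2.trans_eq ?_
    field_simp
  -- If all samples are large, the chosen decision minimises the estimates and is itself misordered
  -- against `x₀`. The two unions produce the factor 2 |χ|.
  have hcov : {ω | xhat t ω y ≠ x₀} ⊆ (⋃ x, G₁ x) ∪ ⋃ x, G₂ x := by
    intro ω hω
    by_cases hall : ∀ x, m x t ≤ psi Y c ξ (fun i => X i ω) (fun i => S i ω) x y t
    · right
      exact Set.mem_iUnion.2 ⟨xhat t ω y, hω, ⟨hall _, hall _⟩,
        hxhat.isMin t ω y (hρ y hyρ).1 (fun x => (hm1 x).trans (hall x)) x₀⟩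
    · left
      push Not at hall
      exact Set.mem_iUnion.2 hall
  have hsum : ∀ G : χ → Set Ω, (∀ x, P (G x) ≤ E) → P (⋃ x, G x) ≤ Nat.card χ * E := by
    intro G hG
    refine (measure_iUnion_fintype_le P G).trans ((Finset.sum_le_card_nsmul _ _ _
      fun x _ => hG x).trans_eq ?_)
    rw [nsmul_eq_mul, Finset.card_univ, Nat.card_eq_fintype_card]
  refine (measure_mono hcov).trans ((measure_union_le _ _).trans ?_)
  refine (add_le_add (hsum _ b₁) (hsum _ b₂)).trans_eq ?_
  ring

end decisions

/-! ### Positivity of the rate on compact sets -/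

section rate

variable {χ : Type*} [Finite χ] [Nontrivial χ] {d : ℕ} {Y : Set (EuclideanSpace ℝ (Fin d))}
  {c ξ : ℝ} {f σ a : χ → EuclideanSpace ℝ (Fin d) → ℝ}

/-- The rate is locally bounded away from zero. -/
theorem eventually_lt_rate (hfc : ∀ x, ContinuousOn (f x) (interior Y))
    (hσpos : ∀ x, ∀ y ∈ interior Y, 0 < σ x y) (hσc : ∀ x, ContinuousOn (σ x) (interior Y))
    (hapos : ∀ x, ∀ y ∈ interior Y, 0 < a x y) (hac : ∀ x, ContinuousOn (a x) (interior Y))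
    (hc : 0 < c) (hξ : 0 < ξ) {y₀ : EuclideanSpace ℝ (Fin d)} (hy₀ : y₀ ∈ interior Y)
    (hMO : y₀ ∉ multiOpt f Y) :
    ∃ ε > 0, ∀ᶠ y in 𝓝 y₀, y ∉ multiOpt f Y → ε ≤ rate c ξ f σ a y := by
  have hnhds := isOpen_interior.mem_nhds hy₀
  have hp : 0 < 1 / (1 + ξ) := by positivity
  set x₀ := xstar f y₀ with hx₀
  -- A term of the rate with the Lambert value replaced by its upper bound 2(ζ + 1), hence an
  -- explicit continuous minorant. The competitor `x₁` that gives ζ for the optimal decision may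
  -- change with `y`, so all pairs are treated.
  set L : χ → χ → EuclideanSpace ℝ (Fin d) → ℝ := fun x₁ x y =>
    (f x₁ y - f x₀ y) ^ 2 / (4 * σ x y ^ 2) *
      (2 * ((f x₁ y - f x₀ y) ^ 2 / (4 * σ x y ^ 2) + 1)) ^ (-(1 / (1 + ξ))) *
      a x y ^ (1 / (1 + ξ)) with hL
  have hfy := fun x => (hfc x).continuousAt hnhds
  have hσy := fun x => (hσc x).continuousAt hnhds
  have hay := fun x => (hac x).continuousAt hnhds
  have hLc : ∀ x₁ x, ContinuousAt (L x₁ x) y₀ := by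
    intro x₁ x
    have h0 := hσpos x y₀ hy₀
    have h1 : ContinuousAt (fun y => (f x₁ y - f x₀ y) ^ 2 / (4 * σ x y ^ 2)) y₀ :=
      (((hfy x₁).sub (hfy x₀)).pow 2).div (((hσy x).pow 2).const_mul 4) (by positivity)
    refine (h1.mul (((h1.add_const 1).const_mul 2).rpow_const (Or.inl ?_))).mul
      ((hay x).rpow_const (Or.inr hp.le))
    positivity
  have hLpos : ∀ x₁ x, x₁ ≠ x₀ → 0 < L x₁ x y₀ := by
    intro x₁ x hx₁
    have h0 := hσpos x y₀ hy₀
    have h1 := hapos x y₀ hy₀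
    have h2 := sub_pos.2 (xstar_lt (interior_subset hy₀) hMO hx₁)
    simp only [hL]
    positivity
  obtain ⟨ε, hε0, hε⟩ : ∃ ε : ℝ, 0 < ε ∧ ∀ x₁ x, x₁ ≠ x₀ → ε < L x₁ x y₀ := by
    have h1 : ∀ᶠ ε in 𝓝[>] (0 : ℝ), 0 < ε := self_mem_nhdsWithin
    have h2 : ∀ᶠ ε in 𝓝[>] (0 : ℝ), ∀ x₁ x, x₁ ≠ x₀ → ε < L x₁ x y₀ := by
      refine eventually_all.2 fun x₁ => eventually_all.2 fun x => ?_
      by_cases hx₁ : x₁ = x₀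
      · exact Eventually.of_forall fun _ h => absurd hx₁ h
      · filter_upwards [nhdsWithin_le_nhds (gt_mem_nhds (hLpos x₁ x hx₁))] with ε h _
        exact h
    exact (h1.and h2).exists
  have hC : 0 < volConst d c ^ (1 / (1 + ξ)) := Real.rpow_pos_of_pos (volConst_pos d hc) _
  refine ⟨volConst d c ^ (1 / (1 + ξ)) * ε, mul_pos hC hε0, ?_⟩
  have ev1 : ∀ᶠ y in 𝓝 y₀, ∀ x, x ≠ x₀ → f x₀ y < f x y := by
    refine eventually_all.2 fun x => ?_
    by_cases hx : x = x₀
    · exact Eventually.of_forall fun _ h => absurd hx h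
    · filter_upwards [(hfy x₀).eventually_lt (hfy x)
        (xstar_lt (interior_subset hy₀) hMO hx)] with y h _
      exact h
  have ev2 : ∀ᶠ y in 𝓝 y₀, ∀ x₁ x, x₁ ≠ x₀ → ε < L x₁ x y := by
    refine eventually_all.2 fun x₁ => eventually_all.2 fun x => ?_
    by_cases hx₁ : x₁ = x₀
    · exact Eventually.of_forall fun _ h => absurd hx₁ h
    · filter_upwards [(hLc x₁ x).eventually_const_lt (hε x₁ x hx₁)] with y h _
      exact h
  filter_upwards [ev1, ev2, hnhds] with y h1 h2 hy hyMO
  have hstar : xstar f y = x₀ := xstar_eq fun x hx => h1 x hx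
  refine mul_le_mul_of_nonneg_left (le_ciInf fun x => ?_) hC.le
  have hζ := zeta_pos (interior_subset hy) hyMO (fun x => hσpos x y hy) x
  obtain ⟨x₁, hx₁, he⟩ : ∃ x₁ ≠ x₀, zeta f σ x y =
      (f x₁ y - f x₀ y) ^ 2 / (4 * σ x y ^ 2) := by
    by_cases hx : x = x₀
    · have := (zeta_xstar f σ y).1
      rw [hstar] at this
      rwa [hx]
    · refine ⟨x, hx, ?_⟩
      rw [zeta_of_ne (by rwa [hstar]), hstar]
  refine (h2 x₁ x hx₁).le.trans ?_
  simp only [hL]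
  rw [← he]
  obtain ⟨hW1, -, hW2⟩ := lambertWm1_spec hζ
  have := Real.rpow_le_rpow_of_nonpos (by linarith) hW2 (neg_nonpos.2 hp.le)
  have ha := hapos x y hy
  gcongr

theorem exists_le_rate_of_isCompact (hfc : ∀ x, ContinuousOn (f x) (interior Y))
    (hσpos : ∀ x, ∀ y ∈ interior Y, 0 < σ x y) (hσc : ∀ x, ContinuousOn (σ x) (interior Y))
    (hapos : ∀ x, ∀ y ∈ interior Y, 0 < a x y) (hac : ∀ x, ContinuousOn (a x) (interior Y))
    (hc : 0 < c) (hξ : 0 < ξ) {K : Set (EuclideanSpace ℝ (Fin d))} (hK : IsCompact K)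
    (hKY : K ⊆ interior Y) (hMO : K ∩ multiOpt f Y = ∅) :
    ∃ ε > 0, ∀ y ∈ K, ε ≤ rate c ξ f σ a y := by
  have hKM : ∀ y ∈ K, y ∉ multiOpt f Y := fun y hy h =>
    Set.notMem_empty y (hMO ▸ (⟨hy, h⟩ : y ∈ K ∩ multiOpt f Y))
  -- The compactness induction runs over sets that need not lie in `K`, so avoidance of the
  -- multi-optimum set is carried as a hypothesis.
  suffices ∃ ε > 0, ∀ y ∈ K, y ∉ multiOpt f Y → ε ≤ rate c ξ f σ a y by
    obtain ⟨ε, hε, h⟩ := this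
    exact ⟨ε, hε, fun y hy => h y hy (hKM y hy)⟩
  refine hK.induction_on (p := fun s => ∃ ε > 0, ∀ y ∈ s, y ∉ multiOpt f Y →
    ε ≤ rate c ξ f σ a y) ⟨1, one_pos, by simp⟩ ?_ ?_ ?_
  · rintro s t hst ⟨ε, hε, h⟩
    exact ⟨ε, hε, fun y hy => h y (hst hy)⟩
  · rintro s t ⟨ε, hε, h⟩ ⟨ε', hε', h'⟩
    refine ⟨min ε ε', lt_min hε hε', ?_⟩
    rintro y (hy | hy) hyM
    · exact (min_le_left _ _).trans (h y hy hyM)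
    · exact (min_le_right _ _).trans (h' y hy hyM)
  · intro y hy
    obtain ⟨ε, hε, h⟩ := eventually_lt_rate hfc hσpos hσc hapos hac hc hξ (hKY hy) (hKM y hy)
    exact ⟨_, mem_nhdsWithin_of_mem_nhds h, ε, hε, fun z hz => hz⟩

end rate

/-! ### From wrong decisions to the loss and its logarithmic rate -/

section loss

variable {χ : Type*} [Finite χ] [Nonempty χ] [MeasurableSpace χ] [DiscreteMeasurableSpace χ]
  {d : ℕ} {f : χ → EuclideanSpace ℝ (Fin d) → ℝ} {δ : ℝ → ℝ → ℝ}
  {Ω : Type*} [MeasurableSpace Ω] {P : Measure Ω}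

/-- A metric vanishes on the diagonal, so only wrong decisions contribute, each at most `M`. -/
theorem condLoss_le (hδ : IsMetric δ) {xhat : Ω → EuclideanSpace ℝ (Fin d) → χ}
    (hx : Measurable (fun p : Ω × EuclideanSpace ℝ (Fin d) => xhat p.1 p.2))
    {y : EuclideanSpace ℝ (Fin d)} {M : ℝ} (hM : ∀ x, δ (f x y) (f (xstar f y) y) ≤ M) :
    condLoss δ f P xhat y ≤ ENNReal.ofReal M * P {ω | xhat ω y ≠ xstar f y} := by
  have hm : MeasurableSet {ω | xhat ω y ≠ xstar f y} :=
    (hx.comp measurable_prodMk_right) (MeasurableSet.of_discrete (s := {xstar f y}ᶜ))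
  rw [← lintegral_indicator_const hm]
  refine lintegral_mono fun ω => ?_
  by_cases h : xhat ω y = xstar f y
  · simp [h, (hδ.eq_zero_iff (f (xstar f y) y) _).2 rfl]
  · rw [Set.indicator_of_mem (by exact h)]
    exact ENNReal.ofReal_le_ofReal (hM _)

theorem totalLoss_le (hδ : IsMetric δ) {xhat : Ω → EuclideanSpace ℝ (Fin d) → χ}
    (hx : Measurable (fun p : Ω × EuclideanSpace ℝ (Fin d) => xhat p.1 p.2))
    (μ : Measure (EuclideanSpace ℝ (Fin d))) [IsProbabilityMeasure μ]
    {K : Set (EuclideanSpace ℝ (Fin d))} (hK : MeasurableSet K) {M : ℝ}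
    (hM : ∀ y ∈ K, ∀ x, δ (f x y) (f (xstar f y) y) ≤ M) {q : ℝ≥0∞}
    (hq : ∀ y ∈ K, P {ω | xhat ω y ≠ xstar f y} ≤ q) :
    totalLoss δ f P xhat μ K ≤ ENNReal.ofReal M * q := by
  refine (setLIntegral_mono' (g := fun _ => ENNReal.ofReal M * q) hK fun y hy => ?_).trans ?_
  · exact (condLoss_le hδ hx (hM y hy)).trans (mul_le_mul_right (hq y hy) _)
  · rw [setLIntegral_const]
    exact mul_le_of_le_one_right' prob_le_one

end loss

/-- A constant factor is absorbed by an arbitrarily small loss in the exponent. -/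
theorem eventually_const_mul_exp_le {p h h' : ℝ} (hp : 0 < p) (hh : h < h') (C : ℝ≥0∞)
    (hC : C ≠ ∞) : ∀ᶠ t : ℕ in atTop, C * ENNReal.ofReal (Real.exp (-h' * (t : ℝ) ^ p)) ≤
      ENNReal.ofReal (Real.exp (-h * (t : ℝ) ^ p)) := by
  have h1 : Tendsto (fun t : ℕ => Real.exp ((h' - h) * (t : ℝ) ^ p)) atTop atTop :=
    Real.tendsto_exp_atTop.comp
      ((tendsto_natCast_rpow_atTop hp).const_mul_atTop (sub_pos.2 hh))
  filter_upwards [h1.eventually_ge_atTop C.toReal] with t ht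
  rw [← ENNReal.ofReal_toReal hC, ← ENNReal.ofReal_mul ENNReal.toReal_nonneg]
  refine ENNReal.ofReal_le_ofReal ?_
  refine (mul_le_mul_of_nonneg_right ht (Real.exp_pos _).le).trans_eq ?_
  rw [← Real.exp_add]
  congr 1
  ring

/-- Exponential upper bounds give a lower bound on the exponential rate. -/
theorem le_liminf_neg_log {p r : ℝ} {u : ℕ → ℝ≥0∞}
    (hu : ∀ h : ℝ, h < r → ∀ᶠ t : ℕ in atTop,
      u t ≤ ENNReal.ofReal (Real.exp (-h * (t : ℝ) ^ p))) :
    (r : EReal) ≤ liminf (fun t : ℕ =>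
      (-((1 / (t : ℝ) ^ p : ℝ) : EReal)) * ENNReal.log (u t)) atTop := by
  by_contra hcon
  obtain ⟨h, h1, h2⟩ := EReal.lt_iff_exists_real_btwn.1 (not_le.1 hcon)
  refine absurd h1 (not_lt.2 (le_liminf_of_le (by isBoundedDefault) ?_))
  filter_upwards [hu h (EReal.coe_lt_coe_iff.1 h2), eventually_gt_atTop 0] with t ht ht0
  have hT : 0 < (t : ℝ) ^ p := Real.rpow_pos_of_pos (by exact_mod_cast ht0) _
  set T : ℝ := (t : ℝ) ^ p
  -- Monotonicity of the extended logarithm also covers a zero loss, whose logarithm is -∞.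
  have h3 := ENNReal.log_monotone ht
  rw [ENNReal.log_ofReal, if_neg (not_le.2 (Real.exp_pos _)), Real.log_exp] at h3
  rw [EReal.neg_mul, EReal.le_neg]
  have h4 : (0 : EReal) ≤ ((1 / T : ℝ) : EReal) := by
    exact_mod_cast (by positivity : (0 : ℝ) ≤ 1 / T)
  refine (mul_le_mul_of_nonneg_left h3 h4).trans_eq ?_
  rw [← EReal.coe_mul, ← EReal.coe_neg]
  congr 1
  field_simp

end SNE

/-! ### The proposition -/

theorem proposition3
    {χ : Type*} [Finite χ] [Nontrivial χ] [MeasurableSpace χ] [DiscreteMeasurableSpace χ]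
    {d : ℕ} (hd : 0 < d)
    (Y : Set (EuclideanSpace ℝ (Fin d))) (hY : Bornology.IsBounded Y)
    -- expected performance: uniformly bounded and Lipschitz on `Y`
    (f : χ → EuclideanSpace ℝ (Fin d) → ℝ)
    (hfb : ∃ B : ℝ, ∀ x, ∀ y ∈ Y, |f x y| ≤ B)
    (L₁ : ℝ≥0) (hf : ∀ x, LipschitzOnWith L₁ (f x) Y)
    -- standard deviation of the noise: positive and Lipschitz on `Y`
    (σ : χ → EuclideanSpace ℝ (Fin d) → ℝ)
    (hσpos : ∀ x, ∀ y ∈ Y, 0 < σ x y)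
    (L₂ : ℝ≥0) (hσ : ∀ x, LipschitzOnWith L₂ (σ x) Y)
    -- sampling density: positive and continuous on the interior of `Y`
    (a : χ → EuclideanSpace ℝ (Fin d) → ℝ)
    (hapos : ∀ x, ∀ y ∈ interior Y, 0 < a x y)
    (hacont : ∀ x, ContinuousOn (a x) (interior Y))
    -- constants of the radii
    (c ξ : ℝ) (hc : 0 < c) (hξ : 0 < ξ)
    -- the data
    {Ω : Type*} [MeasurableSpace Ω] (P : Measure Ω) [IsProbabilityMeasure P]
    (X : ℕ → Ω → χ) (S : ℕ → Ω → EuclideanSpace ℝ (Fin d)) (Z : ℕ → Ω → ℝ)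
    (hsamp : SNE.IsStaticSampling Y a P X S Z)
    -- the inferred decisions
    (xhat : ℕ → Ω → EuclideanSpace ℝ (Fin d) → χ)
    (hxhat : SNE.IsInferred Y c ξ f σ X S Z xhat)
    -- the weights of the contexts
    (μ : Measure (EuclideanSpace ℝ (Fin d))) [IsProbabilityMeasure μ] (hμ : ∀ᵐ y ∂μ, y ∈ Y)
    -- the compact subset
    (Ysub : Set (EuclideanSpace ℝ (Fin d))) (hcomp : IsCompact Ysub) (hne : Ysub.Nonempty)
    (hsub : Ysub ⊆ interior Y) (hMO : Ysub ∩ SNE.multiOpt f Y = ∅)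
    -- the metric that measures the decision loss, which is bounded on `Ysub`
    (δ : ℝ → ℝ → ℝ) (hδ : SNE.IsMetric δ) (hδmeas : Measurable (Function.uncurry δ))
    (hδb : ∃ M : ℝ, ∀ y ∈ Ysub, ∀ x, δ (f x y) (f (SNE.xstar f y) y) ≤ M) :
    0 < SNE.rateSub c ξ f σ a Ysub ∧
    ((SNE.rateSub c ξ f σ a Ysub : ℝ) : EReal) ≤
      liminf (fun t : ℕ =>
        (-((1 / (t : ℝ) ^ (1 / (1 + ξ)) : ℝ) : EReal)) *
          ENNReal.log (SNE.totalLoss δ f P (xhat t) μ Ysub)) atTop ∧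
    (∀ h : ℝ, h < SNE.rateSub c ξ f σ a Ysub → ∀ᶠ t : ℕ in atTop,
      SNE.totalLoss δ f P (xhat t) μ Ysub ≤
        ENNReal.ofReal (Real.exp (-h * (t : ℝ) ^ (1 / (1 + ξ))))) := by 
  have hfc : ∀ x, ContinuousOn (f x) (interior Y) := fun x =>
    (hf x).continuousOn.mono interior_subset
  have hσc : ∀ x, ContinuousOn (σ x) (interior Y) := fun x =>
    (hσ x).continuousOn.mono interior_subset
  have hσpos' : ∀ x, ∀ y ∈ interior Y, 0 < σ x y := fun x y hy => hσpos x y (interior_subset hy)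
  have hp : 0 < 1 / (1 + ξ) := by positivity
  obtain ⟨ε, hε, hrate⟩ := SNE.exists_le_rate_of_isCompact hfc hσpos' hσc hapos hacont hc hξ hcomp
    hsub hMO
  have : Nonempty Ysub := hne.to_subtype
  have hpos : 0 < SNE.rateSub c ξ f σ a Ysub :=
    hε.trans_le (le_ciInf fun y : Ysub => hrate y y.2)
  have hle : ∀ y ∈ Ysub, SNE.rateSub c ξ f σ a Ysub ≤ SNE.rate c ξ f σ a y := fun y hy =>
    ciInf_le (f := fun y : Ysub => SNE.rate c ξ f σ a y.1)
      ⟨ε, by rintro _ ⟨z, rfl⟩; exact hrate z z.2⟩ ⟨y, hy⟩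
  have hdecay : ∀ h : ℝ, h < SNE.rateSub c ξ f σ a Ysub → ∀ᶠ t : ℕ in atTop,
      SNE.totalLoss δ f P (xhat t) μ Ysub ≤
        ENNReal.ofReal (Real.exp (-h * (t : ℝ) ^ (1 / (1 + ξ)))) := by
    intro h hh
    -- The wrong decisions are bounded at rate h'; the spare h' - h absorbs the factor M · 2 |χ|.
    obtain ⟨h', hh1, hh2⟩ := exists_between hh
    obtain ⟨M, hM⟩ := hδb
    have hunif : ∀ᶠ t : ℕ in atTop, ∀ y ∈ Ysub, P {ω | xhat t ω y ≠ SNE.xstar f y} ≤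
        2 * Nat.card χ * ENNReal.ofReal (Real.exp (-h' * (t : ℝ) ^ (1 / (1 + ξ)))) := by
      -- A finite cover by the local neighborhoods gives a single stage from which the bound holds
      -- on all of `Ysub`.
      refine hcomp.induction_on (p := fun s => ∀ᶠ t : ℕ in atTop, ∀ y ∈ s,
        P {ω | xhat t ω y ≠ SNE.xstar f y} ≤
          2 * Nat.card χ * ENNReal.ofReal (Real.exp (-h' * (t : ℝ) ^ (1 / (1 + ξ))))) ?_ ?_ ?_ ?_
      · simp
      · intro s s' hss hs'
        filter_upwards [hs'] with t ht y hy using ht y (hss hy)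
      · intro s s' hs hs'
        filter_upwards [hs, hs'] with t ht ht' y hy
        exact hy.elim (ht y) (ht' y)
      · intro y hy
        obtain ⟨U, hU, hUt⟩ := SNE.exists_nhds_prob_wrong_le hd hfc hσpos' hσc hapos hacont hc hξ
          hsamp hxhat (hsub hy) (fun hm => Set.notMem_empty y (hMO ▸ ⟨hy, hm⟩))
          (hh2.trans_le (hle y hy))
        exact ⟨U, mem_nhdsWithin_of_mem_nhds hU, hUt⟩
    filter_upwards [hunif, SNE.eventually_const_mul_exp_le hp hh1
      (ENNReal.ofReal M * (2 * Nat.card χ)) (by finiteness)] with t h1 h2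
    refine (SNE.totalLoss_le hδ (hxhat.measurable t) μ hcomp.measurableSet hM h1).trans ?_
    rwa [← mul_assoc]
  exact ⟨hpos, SNE.le_liminf_neg_log hdecay, hdecay⟩
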